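/- Let $k\in\mathbb R$ with $e^k+e^{-k}\in\mathbb Z\setminus\{2\}$, and let $G_k$ be the group of real matrices $$\begin{pmatrix} e^{kz}&0&0&x\\0&e^{-kz}&0&y\\0&0&1&z\\0&0&0&1\end{pmatrix},\qquad x,y,z\in\mathbb R .$$ Let $\Gamma_k\subset G_k$ be a discrete subgroup with compact quotient $N_k=G_k/\Gamma_k$. The right invariant forms $dx-kx\,dz$, $dy+ky\,dz$, $dz$ on $G_k$ descend to $1$-forms $\alpha,\beta,\gamma$ on $N_k$. Let $n$ be a nonzero integer, $\lambda\in\mathbb R$, and let $M_{n,k}\to N_k$ be a smooth principal $S^1$-bundle ($S^1=\mathbb R/\mathbb Z$) that carries a connection form with curvature $n\lambda\,\alpha\wedge\beta$ (so its real Chern class is $n\lambda[\alpha\wedge\beta]$; such bundles exist when $\lambda[\alpha\wedge\beta]$ is an integral class). Let $\eta$ be such a connection form, i.e. a smooth $S^1$-invariant $1$-form on $M_{n,k}$ that takes the value $1$ on the vector field generating the action of $\mathbb R/\mathbb Z$, with $d\eta=n\lambda\,\alpha\wedge\beta$. Pullbacks of forms from $N_k$ to $M_{n,k}$ are denoted by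 the same letters. Put $\omega=-k\gamma$, a closed $1$-form on $M_{n,k}$. For a closed $1$-form $\theta$ write $d_\theta\mu=d\mu+\theta\wedge\mu$ and let $H^i_\theta(M_{n,k})=\ker d_\theta/\operatorname{im}d_\theta$ be the Lichnerowicz cohomology in degree $i$ of the complex of smooth forms. 1. The forms $\alpha$, $\alpha\wedge\eta$, $\alpha\wedge\gamma\wedge\eta$ are $d_\omega$-closed and represent nonzero classes in $H^i_\omega(M_{n,k})$ for $i=1,2,3$ respectively. 2. The forms $\beta$, $\beta\wedge\eta$, $\beta\wedge\gamma\wedge\eta$ are $d_{-\omega}$-closed and represent nonzero classes in $H^i_{-\omega}(M_{n,k})$ for $i=1,2,3$ respectively. 3. For all real $t_1,t_2,t_3$ the form $\Omega_{(t_1,t_2,t_3)}=t_1\,\alpha\wedge\eta+t_2\,\beta\wedge\gamma+t_3(n\lambda\,\alpha\wedge\beta-k\,\gamma\wedge\eta)$ is $d_\omega$-closed and $[\Omega_{(t_1,t_2,t_3)}]=t_1[\alpha\wedge\eta]$ in $H^2_\omega(M_{n,k})$. For all real $s_1,s_2,s_3$ the form $\Omega'_{(s_1,s_2,s_3)}=s_1\,\beta\wedge\eta+s_2\,\alpha\wedge\gamma+s_3(n\lambda\,\alpha\wedge\beta+k\,\gamma\wedge\eta)$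 is $d_{-\omega}$-closed and $[\Omega'_{(s_1,s_2,s_3)}]=s_1[\beta\wedge\eta]$ in $H^2_{-\omega}(M_{n,k})$. -/

import Mathlib

open scoped Manifold ContDiff

noncomputable section

namespace ACFM

/-! ### Differential forms on a smooth manifold -/

section Forms

variable {E : Type*} [NormedAddCommGroup E] [NormedSpace ℝ E]
  {M : Type*} [TopologicalSpace M] [ChartedSpace E M]
  {E' : Type*} [NormedAddCommGroup E'] [NormedSpace ℝ E']
  {M' : Type*} [TopologicalSpace M'] [ChartedSpace E' M']

/-- Differential `l`-forms on `M`, without regularity: a section assigns to each `x : M` an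
alternating `l`-form on the tangent space at `x`. (The tangent space `TangentSpace 𝓘(ℝ, E) x` is by
definition the model space `E`.) -/
def Form (E M : Type*) [NormedAddCommGroup E] [NormedSpace ℝ E] (l : ℕ) : Type _ :=
  M → E [⋀^Fin l]→L[ℝ] ℝ

instance {E M : Type*} [NormedAddCommGroup E] [NormedSpace ℝ E] {l : ℕ} :
    AddCommGroup (Form E M l) := inferInstanceAs (AddCommGroup (M → E [⋀^Fin l]→L[ℝ] ℝ))

instance {E M : Type*} [NormedAddCommGroup E] [NormedSpace ℝ E] {l : ℕ} :
    Module ℝ (Form E M l) := inferInstanceAs (Module ℝ (M → E [⋀^Fin l]→L[ℝ] ℝ))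

/-- The pullback `f^* θ` of a form along a map `f`. -/
def pullback {l : ℕ} (f : M → M') (θ : Form E' M' l) : Form E M l := fun x =>
  (θ (f x)).compContinuousLinearMap (mfderiv 𝓘(ℝ, E) 𝓘(ℝ, E') f x : E →L[ℝ] E')

/-- The expression of a form in the preferred chart around `x₀`: its pullback along the inverse
of the chart. It is meaningful on the target of the chart. -/
def chartRep {l : ℕ} (θ : Form E M l) (x₀ : M) : E → E [⋀^Fin l]→L[ℝ] ℝ := fun y =>
  (θ ((chartAt E x₀).symm y)).compContinuousLinearMap
    (mfderiv 𝓘(ℝ, E) 𝓘(ℝ, E) (chartAt E x₀).symm y : E →L[ℝ] E)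

/-- A form is smooth if all its expressions in charts are smooth. -/
def IsSmooth {l : ℕ} (θ : Form E M l) : Prop :=
  ∀ x₀ : M, ContDiffOn ℝ ∞ (chartRep θ x₀) (chartAt E x₀).target

/-- The exterior derivative: in the preferred chart at `x` it is the exterior derivative of the
expression of the form in that chart. -/
def extD {l : ℕ} (θ : Form E M l) : Form E M (l + 1) := fun x =>
  (extDeriv (chartRep θ x) (chartAt E x x)).compContinuousLinearMap
    (mfderiv 𝓘(ℝ, E) 𝓘(ℝ, E) (chartAt E x) x : E →L[ℝ] E)

/-- The wedge product of a `1`-form with an `l`-form,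
`(w ∧ θ)(v₀, …, v_l) = ∑ i, (-1)^i w(v_i) θ(v₀, …, v̂_i, …, v_l)`. -/
def wedge {l : ℕ} (w : Form E M 1) (θ : Form E M l) : Form E M (l + 1) := fun x =>
  ContinuousAlternatingMap.alternatizeUncurryFin
    (((ContinuousAlternatingMap.ofSubsingleton ℝ E ℝ (0 : Fin 1)).symm (w x)).smulRight (θ x))

theorem chartRep_add {l : ℕ} (θ θ' : Form E M l) (x₀ : M) :
    chartRep (θ + θ') x₀ = chartRep θ x₀ + chartRep θ' x₀ := rfl

theorem chartRep_smul {l : ℕ} (c : ℝ) (θ : Form E M l) (x₀ : M) :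
    chartRep (c • θ) x₀ = c • chartRep θ x₀ := rfl

variable (E M) in
/-- The real vector space `Ω^l(M)` of smooth `l`-forms. -/
def smoothForms (l : ℕ) : Submodule ℝ (Form E M l) where
  carrier := {θ | IsSmooth θ}
  zero_mem' := fun x₀ => (contDiffOn_const (c := 0)).congr fun _ _ => rfl
  add_mem' := fun h h' x₀ => by
    rw [chartRep_add]; exact (h x₀).add (h' x₀)
  smul_mem' := fun c θ h x₀ => by
    rw [chartRep_smul]; exact (h x₀).const_smul c

theorem IsSmooth.differentiableAt {l : ℕ} {θ : Form E M l} (h : IsSmooth θ) (x : M) :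
    DifferentiableAt ℝ (chartRep θ x) (chartAt E x x) :=
  ((h x).contDiffAt ((chartAt E x).open_target.mem_nhds
    ((chartAt E x).map_source (mem_chart_source E x)))).differentiableAt (by simp)

theorem extD_add {l : ℕ} {θ θ' : Form E M l} (h : IsSmooth θ) (h' : IsSmooth θ') :
    extD (θ + θ') = extD θ + extD θ' := by
  funext x
  simp only [extD, chartRep_add, extDeriv_add (h.differentiableAt x) (h'.differentiableAt x)]
  rfl

theorem extD_smul {l : ℕ} (c : ℝ) (θ : Form E M l) : extD (c • θ) = c • extD θ := by
  funext x
  simp only [extD, chartRep_smul, extDeriv_smul]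
  rfl

theorem wedge_add {E M : Type*} [NormedAddCommGroup E] [NormedSpace ℝ E] {l : ℕ}
    (w : Form E M 1) (θ θ' : Form E M l) : wedge w (θ + θ') = wedge w θ + wedge w θ' := by
  funext x
  have h : ∀ f : E →L[ℝ] ℝ, f.smulRight (θ x + θ' x) = f.smulRight (θ x) + f.smulRight (θ' x) :=
    fun f => by ext; simp
  exact (congrArg _ (h _)).trans (ContinuousAlternatingMap.alternatizeUncurryFin_add _ _)

theorem wedge_smul {E M : Type*} [NormedAddCommGroup E] [NormedSpace ℝ E] {l : ℕ}
    (w : Form E M 1) (c : ℝ) (θ : Form E M l) : wedge w (c • θ) = c • wedge w θ := by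
  funext x
  have h : ∀ f : E →L[ℝ] ℝ, f.smulRight (c • θ x) = c • f.smulRight (θ x) :=
    fun f => by ext; simp; ring
  exact (congrArg _ (h _)).trans (ContinuousAlternatingMap.alternatizeUncurryFin_smul _ _)

/-- The Lichnerowicz differential `d_w θ = dθ + w ∧ θ` on smooth `l`-forms. -/
def lichD (w : Form E M 1) (l : ℕ) : smoothForms E M l →ₗ[ℝ] Form E M (l + 1) where
  toFun θ := extD θ.1 + wedge w θ.1
  map_add' θ θ' := by
    rw [Submodule.coe_add, extD_add θ.2 θ'.2, wedge_add]
    abel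
  map_smul' c θ := by
    rw [Submodule.coe_smul, extD_smul, wedge_smul, RingHom.id_apply, smul_add]

/-- The kernel of `d_w` in degree `l`. -/
def closedForms (w : Form E M 1) (l : ℕ) : Submodule ℝ (Form E M l) :=
  (LinearMap.ker (lichD w l)).map (smoothForms E M l).subtype

/-- The image of `d_w` in degree `l` (zero in degree `0`). -/
def exactForms (w : Form E M 1) : (l : ℕ) → Submodule ℝ (Form E M l)
  | 0 => ⊥
  | l + 1 => LinearMap.range (lichD w l)

/-- The Lichnerowicz cohomology `H^l_w(M) = Ker d_w / Im d_w`. -/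
abbrev LichCohomology (w : Form E M 1) (l : ℕ) : Type _ :=
  closedForms w l ⧸ (exactForms w l).submoduleOf (closedForms w l)

/-- `Represents w θ c`: the form `θ` is smooth and `d_w`-closed, and `c = [θ] ∈ H^l_w(M)`. -/
def Represents {l : ℕ} (w : Form E M 1) (θ : Form E M l) (c : LichCohomology w l) : Prop :=
  ∃ h : θ ∈ closedForms w l, c = Submodule.Quotient.mk ⟨θ, h⟩

end Forms

/-! ### The solvable group and its compact quotients -/

/-- The group `G_k`, in the coordinates `(x, y, z)`; see `G.toMatrix`. -/
def G (_k : ℝ) : Type := ℝ × ℝ × ℝ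

namespace G

variable {k : ℝ}

/-- The coordinate `x`. -/
def x (g : G k) : ℝ := g.1
/-- The coordinate `y`. -/
def y (g : G k) : ℝ := g.2.1
/-- The coordinate `z`. -/
def z (g : G k) : ℝ := g.2.2

instance : TopologicalSpace (G k) := inferInstanceAs (TopologicalSpace (ℝ × ℝ × ℝ))
instance : T2Space (G k) := inferInstanceAs (T2Space (ℝ × ℝ × ℝ))
instance : ChartedSpace (ℝ × ℝ × ℝ) (G k) :=
  inferInstanceAs (ChartedSpace (ℝ × ℝ × ℝ) (ℝ × ℝ × ℝ))
instance : IsManifold 𝓘(ℝ, ℝ × ℝ × ℝ) ∞ (G k) :=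
  inferInstanceAs (IsManifold 𝓘(ℝ, ℝ × ℝ × ℝ) ∞ (ℝ × ℝ × ℝ))

instance : Mul (G k) :=
  ⟨fun g h => (Real.exp (k * g.z) * h.x + g.x, Real.exp (-(k * g.z)) * h.y + g.y, g.z + h.z)⟩
instance : One (G k) := ⟨(0, 0, 0)⟩
instance : Inv (G k) :=
  ⟨fun g => (-(Real.exp (-(k * g.z)) * g.x), -(Real.exp (k * g.z) * g.y), -g.z)⟩

@[ext] theorem ext {g h : G k} (h1 : g.x = h.x) (h2 : g.y = h.y) (h3 : g.z = h.z) : g = h :=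
  Prod.ext h1 (Prod.ext h2 h3)

@[simp] theorem mul_x (g h : G k) : (g * h).x = Real.exp (k * g.z) * h.x + g.x := rfl
@[simp] theorem mul_y (g h : G k) : (g * h).y = Real.exp (-(k * g.z)) * h.y + g.y := rfl
@[simp] theorem mul_z (g h : G k) : (g * h).z = g.z + h.z := rfl
@[simp] theorem one_x : (1 : G k).x = 0 := rfl
@[simp] theorem one_y : (1 : G k).y = 0 := rfl
@[simp] theorem one_z : (1 : G k).z = 0 := rfl
@[simp] theorem inv_x (g : G k) : g⁻¹.x = -(Real.exp (-(k * g.z)) * g.x) := rfl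
@[simp] theorem inv_y (g : G k) : g⁻¹.y = -(Real.exp (k * g.z) * g.y) := rfl
@[simp] theorem inv_z (g : G k) : g⁻¹.z = -g.z := rfl

instance : Group (G k) := Group.ofLeftAxioms
  (by
    intro a b c
    ext
    · simp [mul_add, Real.exp_add]; ring
    · simp [mul_add, Real.exp_add]; ring
    · simp [add_assoc])
  (by intro a; ext <;> simp)
  (by intro a; ext <;> simp)

/-- The element of `G_k` with coordinates `(x, y, z)` as a matrix. -/
def toMatrix : G k →* Matrix (Fin 4) (Fin 4) ℝ where
  toFun g := !![Real.exp (k * g.z), 0, 0, g.x;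
                0, Real.exp (-(k * g.z)), 0, g.y;
                0, 0, 1, g.z;
                0, 0, 0, 1]
  map_one' := by
    ext i j
    fin_cases i <;> fin_cases j <;> simp
  map_mul' g h := by
    ext i j
    fin_cases i <;> fin_cases j <;>
      simp [Matrix.mul_apply, Fin.sum_univ_four, mul_add, Real.exp_add, add_comm]

theorem toMatrix_injective : Function.Injective (toMatrix (k := k)) := fun _ _ e =>
  ext (congrFun (congrFun e 0) 3) (congrFun (congrFun e 1) 3) (congrFun (congrFun e 2) 3)

theorem continuous_x : Continuous (x (k := k)) := continuous_fst
theorem continuous_y : Continuous (y (k := k)) := continuous_fst.comp continuous_snd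
theorem continuous_z : Continuous (z (k := k)) := continuous_snd.comp continuous_snd

instance : IsTopologicalGroup (G k) where
  continuous_mul := by
    have hx := continuous_x (k := k)
    have hy := continuous_y (k := k)
    have hz := continuous_z (k := k)
    refine Continuous.prodMk ?_ (Continuous.prodMk ?_ ?_)
    · fun_prop
    · fun_prop
    · fun_prop
  continuous_inv := by
    have hx := continuous_x (k := k)
    have hy := continuous_y (k := k)
    have hz := continuous_z (k := k)
    refine Continuous.prodMk ?_ (Continuous.prodMk ?_ ?_)
    · fun_prop
    · fun_prop
    · fun_prop

/-- The differential of the coordinate `x`. -/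
def dx : ℝ × ℝ × ℝ →L[ℝ] ℝ := ContinuousLinearMap.fst ℝ ℝ (ℝ × ℝ)
/-- The differential of the coordinate `y`. -/
def dy : ℝ × ℝ × ℝ →L[ℝ] ℝ :=
  (ContinuousLinearMap.fst ℝ ℝ ℝ).comp (ContinuousLinearMap.snd ℝ ℝ (ℝ × ℝ))
/-- The differential of the coordinate `z`. -/
def dz : ℝ × ℝ × ℝ →L[ℝ] ℝ :=
  (ContinuousLinearMap.snd ℝ ℝ ℝ).comp (ContinuousLinearMap.snd ℝ ℝ (ℝ × ℝ))

/-- The right invariant form `dx - k x dz` on `G_k`. -/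
def alpha (k : ℝ) : Form (ℝ × ℝ × ℝ) (G k) 1 := fun g =>
  ContinuousAlternatingMap.ofSubsingleton ℝ _ ℝ 0 (dx - (k * g.x) • dz)
/-- The right invariant form `dy + k y dz` on `G_k`. -/
def beta (k : ℝ) : Form (ℝ × ℝ × ℝ) (G k) 1 := fun g =>
  ContinuousAlternatingMap.ofSubsingleton ℝ _ ℝ 0 (dy + (k * g.y) • dz)
/-- The right invariant form `dz` on `G_k`. -/
def gamma (k : ℝ) : Form (ℝ × ℝ × ℝ) (G k) 1 := fun _ =>
  ContinuousAlternatingMap.ofSubsingleton ℝ _ ℝ 0 dz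

end G

section Quotient

variable {k : ℝ} (Γ : Subgroup (G k)) [DiscreteTopology Γ]

theorem isLocalHomeomorph_mk : IsLocalHomeomorph (QuotientGroup.mk : G k → G k ⧸ Γ) :=
  (Γ.isQuotientCoveringMap ⟨‹_›⟩).isCoveringMap.isLocalHomeomorph

/-- The manifold structure of `N_k = G_k / Γ_k`: the charts are the local inverses of the
projection `G_k → G_k / Γ_k`, followed by the coordinates `(x, y, z)`. -/
instance : ChartedSpace (ℝ × ℝ × ℝ) (G k ⧸ Γ) :=
  (isLocalHomeomorph_mk Γ).chartedSpaceOfRightInverse (g := Quotient.out) Quotient.out_eq'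

/-- A change of charts of `G_k / Γ_k` is locally a right translation. -/
theorem eventually_localInverseAt_mk (q : G k ⧸ Γ) (g : G k)
    (hg : (QuotientGroup.mk g : G k ⧸ Γ) ∈ ((isLocalHomeomorph_mk Γ).localInverseAt q.out).source) :
    ∃ c ∈ Γ, ∀ᶠ h in nhds g,
      (isLocalHomeomorph_mk Γ).localInverseAt q.out (QuotientGroup.mk h) = h * c := by
  set hf := isLocalHomeomorph_mk Γ
  set s := hf.localInverseAt q.out
  have e1 : QuotientGroup.mk (s (QuotientGroup.mk g)) = (QuotientGroup.mk g : G k ⧸ Γ) :=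
    hf.apply_localInverseAt_of_mem hg
  refine ⟨g⁻¹ * s (QuotientGroup.mk g), QuotientGroup.eq.1 e1.symm, ?_⟩
  have hc : ContinuousAt (fun h : G k => h * (g⁻¹ * s (QuotientGroup.mk g))) g := by fun_prop
  have ht : s.target ∈ nhds (g * (g⁻¹ * s (QuotientGroup.mk g))) := by
    rw [mul_inv_cancel_left]
    exact s.open_target.mem_nhds (s.map_source hg)
  filter_upwards [hc ht] with h hh
  have e2 : s (s.symm (h * (g⁻¹ * s (QuotientGroup.mk g)))) = h * (g⁻¹ * s (QuotientGroup.mk g)) :=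
    s.right_inv hh
  rw [hf.localInverseAt_symm] at e2
  rw [← e2]
  congr 1
  rw [QuotientGroup.eq, inv_mul_cancel_left]
  exact QuotientGroup.eq.1 e1.symm

/-- Right translations in the coordinates `(x, y, z)`. -/
theorem G.contDiff_mul_right (c : G k) :
    ContDiff ℝ ∞ (E := ℝ × ℝ × ℝ) (F := ℝ × ℝ × ℝ) (fun g : G k => g * c) := by
  change ContDiff ℝ ∞ (fun g : ℝ × ℝ × ℝ => ((Real.exp (k * g.2.2) * c.x + g.1,
    Real.exp (-(k * g.2.2)) * c.y + g.2.1, g.2.2 + c.z) : ℝ × ℝ × ℝ))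
  fun_prop

instance : IsManifold 𝓘(ℝ, ℝ × ℝ × ℝ) ∞ (G k ⧸ Γ) := by
  refine isManifold_of_contDiffOn _ _ _ ?_
  rintro e e' ⟨q, rfl⟩ ⟨q', rfl⟩ y hy
  have hy1 := hy.1
  have h3 := congrFun ((isLocalHomeomorph_mk Γ).localInverseAt_symm q.out)
  obtain ⟨c, -, hc⟩ := eventually_localInverseAt_mk Γ q' y (h3 y ▸ hy1.2.1)
  refine ContDiffAt.contDiffWithinAt ?_
  refine (G.contDiff_mul_right c).contDiffAt.congr_of_eventuallyEq ?_
  filter_upwards [hc] with h hh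
  exact (congrArg ((isLocalHomeomorph_mk Γ).localInverseAt q'.out) (h3 h)).trans hh

/-- The form on `G_k / Γ_k` induced by a right invariant form `θ` on `G_k`: near `q` it is the
pullback of `θ` along a local section of the projection. -/
def descend {l : ℕ} (θ : Form (ℝ × ℝ × ℝ) (G k) l) : Form (ℝ × ℝ × ℝ) (G k ⧸ Γ) l := fun q =>
  pullback ((isLocalHomeomorph_mk Γ).localInverseAt q.out) θ q

theorem G.mfderiv_mul_right (c g : G k) :
    (mfderiv 𝓘(ℝ, ℝ × ℝ × ℝ) 𝓘(ℝ, ℝ × ℝ × ℝ) (fun g : G k => g * c) g :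
      ℝ × ℝ × ℝ →L[ℝ] ℝ × ℝ × ℝ) =
    (G.dx + (k * Real.exp (k * g.z) * c.x) • G.dz).prod
      ((G.dy - (k * Real.exp (-(k * g.z)) * c.y) • G.dz).prod G.dz) := by
  have h0 : HasFDerivAt (fun p : ℝ × ℝ × ℝ => p.2.2) G.dz g := G.dz.hasFDerivAt
  have h1 : HasFDerivAt (fun p : ℝ × ℝ × ℝ => p.1) G.dx g := G.dx.hasFDerivAt
  have h2 : HasFDerivAt (fun p : ℝ × ℝ × ℝ => p.2.1) G.dy g := G.dy.hasFDerivAt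
  have e1 := (((h0.const_mul k).exp).mul_const c.x).add h1
  have e2 := (((h0.const_mul k).fun_neg.exp).mul_const c.y).add h2
  have e3 := h0.add_const c.z
  have h := e1.prodMk (e2.prodMk e3)
  refine (mfderiv_eq_fderiv (f := fun p : ℝ × ℝ × ℝ => ((Real.exp (k * p.2.2) * c.x + p.1,
    Real.exp (-(k * p.2.2)) * c.y + p.2.1, p.2.2 + c.z) : ℝ × ℝ × ℝ))).trans (h.fderiv.trans ?_)
  ext <;> simp [G.dx, G.dy, G.dz, G.z] <;> ring

theorem G.alpha_right_invariant (c : G k) :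
    pullback (fun g : G k => g * c) (G.alpha k) = G.alpha k := by
  funext g
  rw [pullback, G.mfderiv_mul_right]
  ext v
  simp [G.alpha, G.dx, G.dy, G.dz]
  ring

theorem G.beta_right_invariant (c : G k) :
    pullback (fun g : G k => g * c) (G.beta k) = G.beta k := by
  funext g
  rw [pullback, G.mfderiv_mul_right]
  ext v
  simp [G.beta, G.dx, G.dy, G.dz]
  ring

theorem G.gamma_right_invariant (c : G k) :
    pullback (fun g : G k => g * c) (G.gamma k) = G.gamma k := by
  funext g
  rw [pullback, G.mfderiv_mul_right]
  ext v
  simp [G.gamma, G.dx, G.dy, G.dz]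

/-- A right invariant form on `G_k` is the pullback of the form that it induces on `G_k / Γ_k`. -/
theorem pullback_descend {l : ℕ} (θ : Form (ℝ × ℝ × ℝ) (G k) l)
    (hθ : ∀ c : G k, pullback (fun g : G k => g * c) θ = θ) :
    pullback (QuotientGroup.mk : G k → G k ⧸ Γ) (descend Γ θ) = θ := by
  funext g
  set q : G k ⧸ Γ := QuotientGroup.mk g with hq
  have hf := isLocalHomeomorph_mk Γ
  have hsrc : q ∈ (hf.localInverseAt q.out).source := by
    have := hf.apply_self_mem_localInverseAt_source (x := q.out)
    rwa [QuotientGroup.out_eq'] at this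
  obtain ⟨c, hcΓ, hc⟩ := eventually_localInverseAt_mk Γ q g hsrc
  have hmul : MDifferentiableAt 𝓘(ℝ, ℝ × ℝ × ℝ) 𝓘(ℝ, ℝ × ℝ × ℝ) (fun h : G k => h * c) g :=
    ((G.contDiff_mul_right c).differentiable (by simp)).mdifferentiable g
  have hs : MDifferentiableAt 𝓘(ℝ, ℝ × ℝ × ℝ) 𝓘(ℝ, ℝ × ℝ × ℝ) (hf.localInverseAt q.out) q :=
    mdifferentiableAt_atlas (I := 𝓘(ℝ, ℝ × ℝ × ℝ)) (chart_mem_atlas (ℝ × ℝ × ℝ) q)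
      (mem_chart_source _ q)
  have hcg : hf.localInverseAt q.out q = g * c := hc.self_of_nhds
  have hm' : MDifferentiableAt 𝓘(ℝ, ℝ × ℝ × ℝ) 𝓘(ℝ, ℝ × ℝ × ℝ)
      (QuotientGroup.mk : G k → G k ⧸ Γ) (g * c) := by
    have h1 : MDifferentiableAt 𝓘(ℝ, ℝ × ℝ × ℝ) 𝓘(ℝ, ℝ × ℝ × ℝ)
        (chartAt (ℝ × ℝ × ℝ) q).symm (chartAt (ℝ × ℝ × ℝ) q q) :=
      mdifferentiableAt_atlas_symm (I := 𝓘(ℝ, ℝ × ℝ × ℝ)) (chart_mem_atlas (ℝ × ℝ × ℝ) q)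
        (mem_chart_target _ q)
    have h2 : MDifferentiableAt 𝓘(ℝ, ℝ × ℝ × ℝ) 𝓘(ℝ, ℝ × ℝ × ℝ)
        (hf.localInverseAt q.out).symm (hf.localInverseAt q.out q) := h1
    rwa [hf.localInverseAt_symm, hcg] at h2
  have hm : MDifferentiableAt 𝓘(ℝ, ℝ × ℝ × ℝ) 𝓘(ℝ, ℝ × ℝ × ℝ)
      (QuotientGroup.mk : G k → G k ⧸ Γ) g := by
    have h1 : (QuotientGroup.mk : G k → G k ⧸ Γ) = QuotientGroup.mk ∘ (fun h : G k => h * c) := by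
      funext h
      exact QuotientGroup.eq.2 (by simpa using hcΓ)
    rw [h1]
    exact MDifferentiableAt.comp g hm' hmul
  have key : (mfderiv 𝓘(ℝ, ℝ × ℝ × ℝ) 𝓘(ℝ, ℝ × ℝ × ℝ) (hf.localInverseAt q.out) q).comp
      (mfderiv 𝓘(ℝ, ℝ × ℝ × ℝ) 𝓘(ℝ, ℝ × ℝ × ℝ) (QuotientGroup.mk : G k → G k ⧸ Γ) g) =
      mfderiv 𝓘(ℝ, ℝ × ℝ × ℝ) 𝓘(ℝ, ℝ × ℝ × ℝ) (fun h : G k => h * c) g :=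
    (mfderiv_comp (I := 𝓘(ℝ, ℝ × ℝ × ℝ)) (I' := 𝓘(ℝ, ℝ × ℝ × ℝ)) (I'' := 𝓘(ℝ, ℝ × ℝ × ℝ))
      g hs hm).symm.trans (Filter.EventuallyEq.mfderiv_eq hc)
  have h1 := congrFun (hθ c) g
  rw [← h1]
  simp only [pullback, descend]
  ext v
  have key2 : ∀ u : ℝ × ℝ × ℝ,
      mfderiv 𝓘(ℝ, ℝ × ℝ × ℝ) 𝓘(ℝ, ℝ × ℝ × ℝ) (hf.localInverseAt q.out) q
      (mfderiv 𝓘(ℝ, ℝ × ℝ × ℝ) 𝓘(ℝ, ℝ × ℝ × ℝ) (QuotientGroup.mk : G k → G k ⧸ Γ) g u) =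
      mfderiv 𝓘(ℝ, ℝ × ℝ × ℝ) 𝓘(ℝ, ℝ × ℝ × ℝ) (fun h : G k => h * c) g u :=
    fun u => congrFun (congrArg DFunLike.coe key) u
  change θ (hf.localInverseAt q.out q) _ = θ (g * c) _
  rw [hcg]
  congr 1
  funext i
  exact key2 (v i)

/-- The form `α` on `N_k`. -/
def alphaN : Form (ℝ × ℝ × ℝ) (G k ⧸ Γ) 1 := descend Γ (G.alpha k)
/-- The form `β` on `N_k`. -/
def betaN : Form (ℝ × ℝ × ℝ) (G k ⧸ Γ) 1 := descend Γ (G.beta k)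
/-- The form `γ` on `N_k`. -/
def gammaN : Form (ℝ × ℝ × ℝ) (G k ⧸ Γ) 1 := descend Γ (G.gamma k)

theorem pullback_alphaN : pullback QuotientGroup.mk (alphaN Γ) = G.alpha k :=
  pullback_descend Γ _ G.alpha_right_invariant
theorem pullback_betaN : pullback QuotientGroup.mk (betaN Γ) = G.beta k :=
  pullback_descend Γ _ G.beta_right_invariant
theorem pullback_gammaN : pullback QuotientGroup.mk (gammaN Γ) = G.gamma k :=
  pullback_descend Γ _ G.gamma_right_invariant

end Quotient

/-! ### Principal circle bundles and connection forms -/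

section Bundle

/-- `π : M → N` is a smooth principal `S¹`-bundle: `S¹` acts smoothly on `M`, the map `π` is smooth,
and around each point of `N` there is a smooth equivariant local trivialization. -/
structure IsPrincipalCircleBundle (B E : Type*) [NormedAddCommGroup B] [NormedSpace ℝ B]
    [NormedAddCommGroup E] [NormedSpace ℝ E]
    {N : Type*} [TopologicalSpace N] [ChartedSpace B N]
    {M : Type*} [TopologicalSpace M] [ChartedSpace E M] [MulAction Circle M]
    (π : M → N) : Prop where
  smooth_action : ContMDiff ((𝓡 1).prod 𝓘(ℝ, E)) 𝓘(ℝ, E) ∞ (fun q : Circle × M => q.1 • q.2)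
  smooth_proj : ContMDiff 𝓘(ℝ, E) 𝓘(ℝ, B) ∞ π
  locally_trivial : ∀ b : N, ∃ e : Bundle.Trivialization Circle π, b ∈ e.baseSet ∧
    ContMDiffOn 𝓘(ℝ, E) (𝓘(ℝ, B).prod (𝓡 1)) ∞ e e.source ∧
    ContMDiffOn (𝓘(ℝ, B).prod (𝓡 1)) 𝓘(ℝ, E) ∞ e.toOpenPartialHomeomorph.symm e.target ∧
    ∀ (c : Circle) (p : M), p ∈ e.source → c • p ∈ e.source ∧ e (c • p) = (π p, c * (e p).2)

/-- `η` is a connection form of the principal `S¹`-bundle `M`, where `S¹ = ℝ/ℤ` has Lie algebra `ℝ`: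
a smooth invariant `1`-form with value `1` on the vector field generating the action
`t ↦ exp(2πit)`. With this normalization the curvature `dη` represents the Chern class. -/
structure IsConnectionForm {E : Type*} [NormedAddCommGroup E] [NormedSpace ℝ E]
    {M : Type*} [TopologicalSpace M] [ChartedSpace E M] [MulAction Circle M]
    (η : Form E M 1) : Prop where
  smooth : IsSmooth η
  invariant : ∀ c : Circle, pullback (fun p : M => c • p) η = η
  normalized : ∀ p : M,
    pullback (E := ℝ) (fun t : ℝ => Circle.exp (2 * Real.pi * t) • p) η 0 (fun _ => 1) = 1

end Bundle

end ACFM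

end

/-! Everything follows from one fact: the volume form α∧β∧γ∧η on the total space is not exact
(`extD_ne_volumeForm`).

Reduction to that fact. The structure equations are dα = kγ∧α, dβ = -kγ∧β, dγ = 0. Since the twist
of d_ω is -kγ, wedging with β removes it: d(β∧μ) = -β∧d_ω μ. If α∧γ∧η, α∧η or α were d_ω μ, then up
to sign β∧μ, γ∧β∧μ or η∧γ∧β∧μ respectively would be a primitive of the volume form; in the last case
the extra term dη∧γ∧β∧μ contains β twice and vanishes. The remaining terms of Ω are exact: d_ω β =
2k β∧γ and d_ω η = nλ α∧β - kγ∧η. Exchanging α with β, and k and nλ with their negatives, gives the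
statements for -ω. This algebra is `lichnerowicz_classes`.

Non-exactness is proved on ℝ³, without integration over M. In coordinates (u, v, z) on G_k one has α
= e^{kz}du, β = e^{-kz}dv, γ = dz. Suppose dν is the volume form. Integrating three components of ν
over the circle fibres gives a vector field on ℝ³ of divergence 1, because the derivative along the
fibre integrates to zero. Each component of the field is a continuous function on the compact
quotient divided by e^{kz}, e^{-kz} or 1. Hence the third component is bounded and the other two are
bounded on slabs of bounded z. The divergence theorem on the box [0,l]×[0,l]×[0,r] then yields l²r ≤
4Alr + 2Cl², which fails for r > 2C and l large (`false_of_divergence_eq_one`). -/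

noncomputable section

namespace ACFM

/-! ### Exterior algebra on a normed space and the Leibniz rule for `extDeriv`. -/

section Pointwise

open ContinuousAlternatingMap

variable {E : Type*} [NormedAddCommGroup E] [NormedSpace ℝ E]
  {F : Type*} [NormedAddCommGroup F] [NormedSpace ℝ F]

theorem eq_zero_of_eq_neg {V : Type*} [AddCommGroup V] [Module ℝ V] {x : V} (h : x = -x) :
    x = 0 := by
  have h2 : (2 : ℝ) • x = 0 := by
    rw [two_smul]
    exact add_eq_zero_iff_eq_neg.2 h
  exact (smul_eq_zero.1 h2).resolve_left two_ne_zero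

/-- The wedge product of an alternating `1`-form with an alternating `l`-form, as a continuous
bilinear map. -/
def wedgeL (E : Type*) [NormedAddCommGroup E] [NormedSpace ℝ E] (l : ℕ) :
    (E [⋀^Fin 1]→L[ℝ] ℝ) →L[ℝ] (E [⋀^Fin l]→L[ℝ] ℝ) →L[ℝ] (E [⋀^Fin (l + 1)]→L[ℝ] ℝ) :=
  (ContinuousLinearMap.compL ℝ _ _ _ (alternatizeUncurryFinCLM ℝ E ℝ)) ∘L
    (ContinuousLinearMap.smulRightL ℝ E (E [⋀^Fin l]→L[ℝ] ℝ)) ∘L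
    ((ofSubsingletonLIE (𝕜 := ℝ) (E := E) (F := ℝ) (0 : Fin 1)).symm.toContinuousLinearEquiv :
      (E [⋀^Fin 1]→L[ℝ] ℝ) →L[ℝ] (E →L[ℝ] ℝ))

theorem wedgeL_apply {l : ℕ} (a : E [⋀^Fin 1]→L[ℝ] ℝ) (θ : E [⋀^Fin l]→L[ℝ] ℝ)
    (v : Fin (l + 1) → E) :
    wedgeL E l a θ v = ∑ i : Fin (l + 1), (-1) ^ (i : ℕ) * (a (fun _ => v i) * θ (i.removeNth v)) := by
  change alternatizeUncurryFin
    (((ofSubsingleton ℝ E ℝ (0 : Fin 1)).symm a).smulRight θ) v = _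
  rw [alternatizeUncurryFin_apply]
  refine Finset.sum_congr rfl fun i _ => ?_
  simp

theorem wedgeL_compContinuousLinearMap {l : ℕ} (a : E [⋀^Fin 1]→L[ℝ] ℝ)
    (θ : E [⋀^Fin l]→L[ℝ] ℝ) (L : F →L[ℝ] E) :
    (wedgeL E l a θ).compContinuousLinearMap L =
      wedgeL F l (a.compContinuousLinearMap L) (θ.compContinuousLinearMap L) := by
  ext v
  simp only [compContinuousLinearMap_apply, wedgeL_apply]
  rfl

/-- The wedge product of `∑ a_i ∧ b_i` with `θ` depends only on the alternatization of `∑ a_i ⊗ b_i`. -/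
theorem alternatizeUncurryFin_wedgeL_congr {l : ℕ} {A B : E →L[ℝ] E [⋀^Fin 1]→L[ℝ] ℝ}
    (h : alternatizeUncurryFin A = alternatizeUncurryFin B) (θ : E [⋀^Fin l]→L[ℝ] ℝ) :
    alternatizeUncurryFin ((wedgeL E l).flip θ ∘L A) =
      alternatizeUncurryFin ((wedgeL E l).flip θ ∘L B) := by
  have key : alternatizeUncurryFin ((wedgeL E l).flip θ ∘L (A - B)) = 0 := by
    -- The left side is the double alternatization of (x, y) ↦ (A - B)(x)(y) • θ. This map is
    -- symmetric because A - B has zero alternatization, so its double alternatization vanishes.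
    refine alternatizeUncurryFin_alternatizeUncurryFinCLM_comp_of_symmetric
      (f := ((ContinuousLinearMap.smulRightL ℝ E (E [⋀^Fin l]→L[ℝ] ℝ)).flip θ) ∘L
        ((ofSubsingletonLIE (𝕜 := ℝ) (E := E) (F := ℝ) (0 : Fin 1)).symm.toContinuousLinearEquiv :
        (E [⋀^Fin 1]→L[ℝ] ℝ) →L[ℝ] (E →L[ℝ] ℝ)) ∘L (A - B)) fun x y => ?_
    have h1 := congrArg (fun f => f ![x, y]) h
    simp only [alternatizeUncurryFin_apply] at h1
    have e0 : Fin.removeNth 0 ![x, y] = fun _ => y := by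
      ext i; fin_cases i; rfl
    have e1 : Fin.removeNth 1 ![x, y] = fun _ => x := by
      ext i; fin_cases i; rfl
    simp [e0, e1] at h1
    have h2 : ((A - B) x) (fun _ => y) = ((A - B) y) (fun _ => x) := by
      simp; linarith
    change ((A - B) x) (fun _ => y) • θ = ((A - B) y) (fun _ => x) • θ
    rw [h2]
  rw [ContinuousLinearMap.comp_sub] at key
  have := (map_sub (alternatizeUncurryFinCLM ℝ E ℝ) ((wedgeL E l).flip θ ∘L A)
    ((wedgeL E l).flip θ ∘L B)).symm.trans key
  exact sub_eq_zero.1 this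

/-- The covector that corresponds to an alternating `1`-form. -/
def covec (a : E [⋀^Fin 1]→L[ℝ] ℝ) : E →L[ℝ] ℝ := (ofSubsingleton ℝ E ℝ (0 : Fin 1)).symm a

theorem alternatizeUncurryFin_smulRight {l : ℕ} (a : E [⋀^Fin 1]→L[ℝ] ℝ)
    (θ : E [⋀^Fin l]→L[ℝ] ℝ) :
    alternatizeUncurryFin ((covec a).smulRight θ) = wedgeL E l a θ := rfl

theorem wedgeL_one_apply (a b : E [⋀^Fin 1]→L[ℝ] ℝ) (v : Fin 2 → E) :
    wedgeL E 1 a b v = a (fun _ => v 0) * b (fun _ => v 1) - a (fun _ => v 1) * b (fun _ => v 0) := by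
  have e0 : Fin.removeNth 0 v = fun _ => v 1 := by
    ext i; fin_cases i; rfl
  have e1 : Fin.removeNth 1 v = fun _ => v 0 := by
    ext i; fin_cases i; rfl
  refine (wedgeL_apply a b v).trans ((Fin.sum_univ_two _).trans ?_)
  rw [e0, e1]
  simp
  ring

theorem wedgeL_one_comm (a b : E [⋀^Fin 1]→L[ℝ] ℝ) : wedgeL E 1 a b = -wedgeL E 1 b a := by
  ext v
  rw [ContinuousAlternatingMap.neg_apply, wedgeL_one_apply, wedgeL_one_apply]
  ring

theorem wedgeL_one_self (a : E [⋀^Fin 1]→L[ℝ] ℝ) : wedgeL E 1 a a = 0 :=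
  eq_zero_of_eq_neg (wedgeL_one_comm a a)

theorem alternatizeUncurryFin_wedgeL_smulRight {l : ℕ} (a b : E [⋀^Fin 1]→L[ℝ] ℝ)
    (θ : E [⋀^Fin l]→L[ℝ] ℝ) :
    alternatizeUncurryFin ((wedgeL E l).flip θ ∘L (covec a).smulRight b) =
      wedgeL E (l + 1) a (wedgeL E l b θ) := by
  rw [← alternatizeUncurryFin_smulRight]
  congr 1
  ext v : 1
  simp

/-- The degree of θ plays no role: a ⊗ b and -(b ⊗ a) have the same alternatization, so
`alternatizeUncurryFin_wedgeL_congr` reduces the claim to 1-forms. -/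
theorem wedgeL_comm {l : ℕ} (a b : E [⋀^Fin 1]→L[ℝ] ℝ) (θ : E [⋀^Fin l]→L[ℝ] ℝ) :
    wedgeL E (l + 1) a (wedgeL E l b θ) = -wedgeL E (l + 1) b (wedgeL E l a θ) := by
  rw [← alternatizeUncurryFin_wedgeL_smulRight, ← alternatizeUncurryFin_wedgeL_smulRight]
  have h : alternatizeUncurryFin ((covec a).smulRight b) =
      alternatizeUncurryFin (-(covec b).smulRight a) := by
    rw [alternatizeUncurryFin_smulRight, wedgeL_one_comm, ← alternatizeUncurryFin_smulRight]
    exact (map_neg (alternatizeUncurryFinCLM ℝ E ℝ) _).symm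
  rw [alternatizeUncurryFin_wedgeL_congr h, ContinuousLinearMap.comp_neg]
  exact map_neg (alternatizeUncurryFinCLM ℝ E ℝ) _

theorem wedgeL_self {l : ℕ} (a : E [⋀^Fin 1]→L[ℝ] ℝ) (θ : E [⋀^Fin l]→L[ℝ] ℝ) :
    wedgeL E (l + 1) a (wedgeL E l a θ) = 0 :=
  eq_zero_of_eq_neg (wedgeL_comm a a θ)

/-- The double alternatization is a signed sum of differences f(v_i)(v_j) - f(v_j)(v_i), each of
which changes sign under the flip. -/
theorem alternatizeUncurryFin_flip {l : ℕ} (f : E →L[ℝ] E →L[ℝ] E [⋀^Fin l]→L[ℝ] ℝ) :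
    alternatizeUncurryFin (alternatizeUncurryFinCLM ℝ E ℝ ∘L f.flip) =
      -alternatizeUncurryFin (alternatizeUncurryFinCLM ℝ E ℝ ∘L f) := by
  ext v
  rw [ContinuousAlternatingMap.neg_apply, alternatizeUncurryFin_alternatizeUncurryFinCLM_comp_apply,
    alternatizeUncurryFin_alternatizeUncurryFinCLM_comp_apply]
  simp only [← Finset.sum_neg_distrib, ← smul_neg, neg_sub, ContinuousLinearMap.flip_apply]

/-- The source of the minus sign in the Leibniz rule: both sides are double alternatizations, one of
(x, y) ↦ a(x) T(y) and the other of its flip. -/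
theorem alternatizeUncurryFin_wedgeL_comp {l : ℕ} (a : E [⋀^Fin 1]→L[ℝ] ℝ)
    (T : E →L[ℝ] E [⋀^Fin l]→L[ℝ] ℝ) :
    alternatizeUncurryFin (wedgeL E l a ∘L T) = -wedgeL E (l + 1) a (alternatizeUncurryFin T) := by
  let f : E →L[ℝ] E →L[ℝ] E [⋀^Fin l]→L[ℝ] ℝ := (covec a).smulRight T
  have h1 : wedgeL E l a ∘L T = alternatizeUncurryFinCLM ℝ E ℝ ∘L f.flip := by
    ext v : 1
    change alternatizeUncurryFin ((covec a).smulRight (T v)) = alternatizeUncurryFin (f.flip v)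
    congr 1
  have h2 : (covec a).smulRight (alternatizeUncurryFin T) =
      alternatizeUncurryFinCLM ℝ E ℝ ∘L f := by
    ext v : 1
    exact (map_smul (alternatizeUncurryFinCLM ℝ E ℝ) (covec a v) T).symm
  rw [← alternatizeUncurryFin_smulRight, h1, h2, alternatizeUncurryFin_flip]

/-- Only 1-forms with decomposable derivative c a∧b occur, so the term dW∧Θ can be written as c
a∧(b∧Θ), and a product of a 2-form with an `l`-form is never needed. -/
theorem extDeriv_wedgeL {l : ℕ} {W : E → E [⋀^Fin 1]→L[ℝ] ℝ} {Θ : E → E [⋀^Fin l]→L[ℝ] ℝ} {x : E}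
    (hW : DifferentiableAt ℝ W x) (hΘ : DifferentiableAt ℝ Θ x) {c : ℝ}
    {a b : E [⋀^Fin 1]→L[ℝ] ℝ} (h : extDeriv W x = c • wedgeL E 1 a b) :
    extDeriv (fun y => wedgeL E l (W y) (Θ y)) x =
      c • wedgeL E (l + 1) a (wedgeL E l b (Θ x)) - wedgeL E (l + 1) (W x) (extDeriv Θ x) := by
  have hd : fderiv ℝ (fun y => wedgeL E l (W y) (Θ y)) x =
      wedgeL E l (W x) ∘L fderiv ℝ Θ x + (wedgeL E l).flip (Θ x) ∘L fderiv ℝ W x := by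
    rw [((wedgeL E l).hasFDerivAt_of_bilinear hW.hasFDerivAt hΘ.hasFDerivAt).fderiv]
    ext v : 1
    simp
  -- Only the alternatization of `fderiv ℝ W x` is known; by `alternatizeUncurryFin_wedgeL_congr`
  -- that is enough to replace it by c a ⊗ b.
  have h' : alternatizeUncurryFin (fderiv ℝ W x) =
      alternatizeUncurryFin (c • (covec a).smulRight b) := by
    rw [alternatizeUncurryFin_smul, alternatizeUncurryFin_smulRight]
    exact h
  rw [extDeriv, hd, alternatizeUncurryFin_add, alternatizeUncurryFin_wedgeL_comp,
    alternatizeUncurryFin_wedgeL_congr h', ContinuousLinearMap.comp_smul,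
    alternatizeUncurryFin_smul, alternatizeUncurryFin_wedgeL_smulRight, extDeriv]
  abel

end Pointwise

/-! ### Smooth dependence of alternating forms on parameters. -/

section Smoothness

variable {E : Type*} [NormedAddCommGroup E] [NormedSpace ℝ E] [FiniteDimensional ℝ E]
  {F : Type*} [NormedAddCommGroup F] [NormedSpace ℝ F]
  {D : Type*} [NormedAddCommGroup D] [NormedSpace ℝ D]

/-- Alternating forms on a finite-dimensional space are determined by finitely many values, so they
can be recovered from these values by a continuous linear map. -/
theorem exists_leftInverse_eval (E : Type*) [NormedAddCommGroup E] [NormedSpace ℝ E]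
    [FiniteDimensional ℝ E] (l : ℕ) :
    ∃ (ι : Type) (_ : Fintype ι) (v : ι → Fin l → E)
      (S : (ι → ℝ) →L[ℝ] (E [⋀^Fin l]→L[ℝ] ℝ)), ∀ f : E [⋀^Fin l]→L[ℝ] ℝ, S (fun i => f (v i)) = f := by
  let b := Module.finBasis ℝ E
  let ev : (E [⋀^Fin l]→L[ℝ] ℝ) →ₗ[ℝ] ((Fin l → Fin (Module.finrank ℝ E)) → ℝ) :=
    { toFun := fun f i => f (fun j => b (i j))
      map_add' := fun _ _ => rfl
      map_smul' := fun _ _ => rfl }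
  have hinj : LinearMap.ker ev = ⊥ := by
    refine LinearMap.ker_eq_bot.2 fun f g h => ?_
    apply ContinuousAlternatingMap.toAlternatingMap_injective
    refine Module.Basis.ext_alternating b fun i _ => ?_
    exact congrFun h i
  obtain ⟨S, hS⟩ := LinearMap.exists_leftInverse_of_injective ev hinj
  exact ⟨Fin l → Fin (Module.finrank ℝ E), inferInstance, fun i j => b (i j), LinearMap.toContinuousLinearMap S,
    fun f => LinearMap.congr_fun hS f⟩

theorem contDiffAt_of_forall_apply {l : ℕ} {n : ℕ∞ω} {f : D → E [⋀^Fin l]→L[ℝ] ℝ} {x : D}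
    (h : ∀ v, ContDiffAt ℝ n (fun y => f y v) x) : ContDiffAt ℝ n f x := by
  obtain ⟨ι, _, v, S, hS⟩ := exists_leftInverse_eval E l
  have : f = fun y => S (fun i => f y (v i)) := funext fun y => (hS (f y)).symm
  rw [this]
  exact S.contDiff.contDiffAt.comp x (contDiffAt_pi.2 fun i => h (v i))

/-- For fixed arguments the value is linear in `f y` and is a continuous multilinear expression in
`l` copies of `g y`. -/
theorem contDiffAt_compContinuousLinearMap {l : ℕ} {n : ℕ∞ω} {f : D → F [⋀^Fin l]→L[ℝ] ℝ}
    {g : D → E →L[ℝ] F} {x : D} (hf : ContDiffAt ℝ n f x) (hg : ContDiffAt ℝ n g x) :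
    ContDiffAt ℝ n (fun y => (f y).compContinuousLinearMap (g y)) x := by
  refine contDiffAt_of_forall_apply fun v => ?_
  let C := ContinuousMultilinearMap.compContinuousLinearMapContinuousMultilinear ℝ
    (fun _ : Fin l => E) (fun _ => F) ℝ
  have hC : ContDiff ℝ n (fun m : Fin l → E →L[ℝ] F => C m) :=
    @ContinuousMultilinearMap.contDiff ℝ _ ((F [×l]→L[ℝ] ℝ) →L[ℝ] (E [×l]→L[ℝ] ℝ)) _ _ (Fin l)
      (fun _ => E →L[ℝ] F) _ _ _ C n
  have h1 : ContDiffAt ℝ n (fun y => C (fun _ => g y)) x :=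
    hC.contDiffAt.comp x (contDiffAt_pi.2 fun _ => hg)
  have h2 : ContDiffAt ℝ n
      (fun y => ContinuousAlternatingMap.toContinuousMultilinearMapCLM ℝ (f y)) x :=
    (ContinuousLinearMap.contDiff _).contDiffAt.comp x hf
  exact (ContinuousMultilinearMap.apply ℝ (fun _ : Fin l => E) ℝ v).contDiff.contDiffAt.comp x
    (h1.clm_apply h2)

theorem contDiffAt_wedgeL {l : ℕ} {n : ℕ∞ω} {f : D → F [⋀^Fin 1]→L[ℝ] ℝ}
    {g : D → F [⋀^Fin l]→L[ℝ] ℝ} {x : D} (hf : ContDiffAt ℝ n f x) (hg : ContDiffAt ℝ n g x) :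
    ContDiffAt ℝ n (fun y => wedgeL F l (f y) (g y)) x :=
  (ContDiffAt.comp (g := ⇑(wedgeL F l)) x (ContinuousLinearMap.contDiff _).contDiffAt hf).clm_apply
    hg

end Smoothness

end ACFM

end

noncomputable section

namespace ACFM

open Filter Topology

/-! ### Functoriality of the pullback. -/

section Pullback

variable {E : Type*} [NormedAddCommGroup E] [NormedSpace ℝ E]
  {M : Type*} [TopologicalSpace M] [ChartedSpace E M]
  {E' : Type*} [NormedAddCommGroup E'] [NormedSpace ℝ E']
  {M' : Type*} [TopologicalSpace M'] [ChartedSpace E' M']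
  {E'' : Type*} [NormedAddCommGroup E''] [NormedSpace ℝ E'']
  {M'' : Type*} [TopologicalSpace M''] [ChartedSpace E'' M'']

theorem pullback_congr {l : ℕ} {f g : M → M'} {x : M} (h : f =ᶠ[𝓝 x] g) (θ : Form E' M' l) :
    pullback (E := E) f θ x = pullback g θ x := by
  simp only [pullback]
  rw [h.self_of_nhds, h.mfderiv_eq]

theorem pullback_comp {l : ℕ} {f : M → M'} {g : M' → M''} {x : M}
    (hg : MDifferentiableAt 𝓘(ℝ, E') 𝓘(ℝ, E'') g (f x))
    (hf : MDifferentiableAt 𝓘(ℝ, E) 𝓘(ℝ, E') f x) (θ : Form E'' M'' l) :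
    pullback (E := E) (g ∘ f) θ x = pullback f (pullback (E := E') g θ) x := by
  simp only [pullback]
  rw [mfderiv_comp x hg hf]
  rfl

theorem pullback_id {l : ℕ} (θ : Form E M l) : pullback (E := E) (id : M → M) θ = θ := by
  funext x
  simp only [pullback, mfderiv_id]
  ext v
  rfl

theorem pullback_wedge {l : ℕ} (f : M → M') (w : Form E' M' 1) (θ : Form E' M' l) :
    pullback (E := E) f (wedge w θ) = wedge (pullback f w) (pullback f θ) :=
  funext fun _ => wedgeL_compContinuousLinearMap _ _ _

theorem pullback_smul {l : ℕ} (f : M → M') (c : ℝ) (θ : Form E' M' l) :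
    pullback (E := E) f (c • θ) = c • pullback f θ := rfl

theorem pullback_apply_congr {l : ℕ} (f : M → M') {θ θ' : Form E' M' l} {x : M}
    (h : θ (f x) = θ' (f x)) : pullback (E := E) f θ x = pullback f θ' x := by
  simp only [pullback, h]

theorem chartRep_eq_pullback {l : ℕ} (θ : Form E M l) (x₀ : M) :
    chartRep θ x₀ = pullback (E := E) (chartAt E x₀).symm θ := rfl

theorem chartRep_wedge {l : ℕ} (w : Form E M 1) (θ : Form E M l) (x₀ : M) :
    chartRep (wedge w θ) x₀ = fun y => wedgeL E l (chartRep w x₀ y) (chartRep θ x₀ y) :=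
  pullback_wedge _ _ _

theorem isSmooth_iff {l : ℕ} {θ : Form E M l} :
    IsSmooth θ ↔ ∀ x₀ : M, ∀ p ∈ (chartAt E x₀).source,
      ContDiffAt ℝ ∞ (chartRep θ x₀) (chartAt E x₀ p) := by
  refine forall_congr' fun x₀ => ⟨fun h p hp => ?_, fun h y hy => ?_⟩
  · exact h.contDiffAt ((chartAt E x₀).open_target.mem_nhds ((chartAt E x₀).map_source hp))
  · have := h _ ((chartAt E x₀).map_target hy)
    rw [(chartAt E x₀).right_inv hy] at this
    exact this.contDiffWithinAt

theorem IsSmooth.wedge {l : ℕ} {w : Form E M 1} {θ : Form E M l} (hw : IsSmooth w)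
    (hθ : IsSmooth θ) : IsSmooth (wedge w θ) := by
  rw [isSmooth_iff] at *
  intro x₀ p hp
  rw [chartRep_wedge]
  exact contDiffAt_wedgeL (hw x₀ p hp) (hθ x₀ p hp)

end Pullback

/-! ### Naturality of the exterior derivative and the Leibniz rule on manifolds. -/

section Naturality

variable {E : Type*} [NormedAddCommGroup E] [NormedSpace ℝ E]
  {M : Type*} [TopologicalSpace M] [ChartedSpace E M] [IsManifold 𝓘(ℝ, E) ∞ M]
  {F : Type*} [NormedAddCommGroup F] [NormedSpace ℝ F]

theorem minSmoothness_two_le : minSmoothness ℝ 2 ≤ (∞ : ℕ∞ω) := by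
  rw [minSmoothness_of_isRCLikeNormedField]
  exact WithTop.coe_le_coe.2 (le_top : (2 : ℕ∞) ≤ ⊤)

theorem mdifferentiableAt_chartAt {x₀ p : M} (hp : p ∈ (chartAt E x₀).source) :
    MDifferentiableAt 𝓘(ℝ, E) 𝓘(ℝ, E) (chartAt E x₀) p :=
  have : IsManifold 𝓘(ℝ, E) 1 M := .of_le (n := ∞) (by simp)
  mdifferentiableAt_atlas (chart_mem_atlas E x₀) hp

theorem mdifferentiableAt_chartAt_symm {x₀ : M} {y : E} (hy : y ∈ (chartAt E x₀).target) :
    MDifferentiableAt 𝓘(ℝ, E) 𝓘(ℝ, E) (chartAt E x₀).symm y :=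
  have : IsManifold 𝓘(ℝ, E) 1 M := .of_le (n := ∞) (by simp)
  mdifferentiableAt_atlas_symm (chart_mem_atlas E x₀) hy

theorem contMDiffAt_chartAt {x₀ p : M} (hp : p ∈ (chartAt E x₀).source) :
    ContMDiffAt 𝓘(ℝ, E) 𝓘(ℝ, E) ∞ (chartAt E x₀) p :=
  (contMDiffOn_chart (I := 𝓘(ℝ, E)) (x := x₀)).contMDiffAt
    ((chartAt E x₀).open_source.mem_nhds hp)

theorem contMDiffAt_chartAt_symm {x₀ : M} {y : E} (hy : y ∈ (chartAt E x₀).target) :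
    ContMDiffAt 𝓘(ℝ, E) 𝓘(ℝ, E) ∞ (chartAt E x₀).symm y :=
  (contMDiffOn_chart_symm (I := 𝓘(ℝ, E)) (x := x₀)).contMDiffAt
    ((chartAt E x₀).open_target.mem_nhds hy)

theorem ContMDiffAt.eventually_mdifferentiableAt {E' : Type*} [NormedAddCommGroup E']
    [NormedSpace ℝ E'] {M' : Type*} [TopologicalSpace M'] [ChartedSpace E' M']
    [IsManifold 𝓘(ℝ, E') ∞ M'] {f : M → M'} {x : M}
    (hf : ContMDiffAt 𝓘(ℝ, E) 𝓘(ℝ, E') ∞ f x) :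
    ∀ᶠ y in 𝓝 x, MDifferentiableAt 𝓘(ℝ, E) 𝓘(ℝ, E') f y := by
  have i1 : IsManifold 𝓘(ℝ, E) 1 M := .of_le (n := ∞) (by simp)
  have i2 : IsManifold 𝓘(ℝ, E') 1 M' := .of_le (n := ∞) (by simp)
  have h1 : ContMDiffAt 𝓘(ℝ, E) 𝓘(ℝ, E') 1 f x := hf.of_le (by simp)
  filter_upwards [(contMDiffAt_iff_contMDiffAt_nhds (by simp)).1 h1] with y hy
  exact hy.mdifferentiableAt (by simp)

/-- Turns a pullback from the manifold into a pullback between vector spaces along `chartAt E x₀ ∘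
Ψ`, where smoothness and naturality of `extDeriv` are available. -/
theorem pullback_eventuallyEq_chartRep {l : ℕ} (θ : Form E M l) {Ψ : F → M} {y : F} {x₀ : M}
    (hΨ : ContMDiffAt 𝓘(ℝ, F) 𝓘(ℝ, E) ∞ Ψ y) (hy : Ψ y ∈ (chartAt E x₀).source) :
    pullback (E := F) Ψ θ =ᶠ[𝓝 y] fun y' => (chartRep θ x₀ (chartAt E x₀ (Ψ y'))).compContinuousLinearMap
      (fderiv ℝ (chartAt E x₀ ∘ Ψ) y') := by
  have hs : ∀ᶠ y' in 𝓝 y, Ψ y' ∈ (chartAt E x₀).source :=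
    hΨ.continuousAt.eventually_mem ((chartAt E x₀).open_source.mem_nhds hy)
  filter_upwards [hs, hs.eventually_nhds, ContMDiffAt.eventually_mdifferentiableAt hΨ]
    with y' h1 h2 h3
  have e : Ψ =ᶠ[𝓝 y'] (chartAt E x₀).symm ∘ (chartAt E x₀ ∘ Ψ) := by
    filter_upwards [h2] with z hz
    exact ((chartAt E x₀).left_inv hz).symm
  rw [pullback_congr e, pullback_comp (f := chartAt E x₀ ∘ Ψ)
    (mdifferentiableAt_chartAt_symm ((chartAt E x₀).map_source h1))
    ((mdifferentiableAt_chartAt h1).comp y' h3)]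
  simp only [pullback, chartRep, mfderiv_eq_fderiv]
  rfl

theorem contDiffAt_chartAt_comp {Ψ : F → M} {y : F} {x₀ : M}
    (hΨ : ContMDiffAt 𝓘(ℝ, F) 𝓘(ℝ, E) ∞ Ψ y) (hy : Ψ y ∈ (chartAt E x₀).source) :
    ContDiffAt ℝ ∞ (chartAt E x₀ ∘ Ψ) y :=
  contMDiffAt_iff_contDiffAt.1 ((contMDiffAt_chartAt hy).comp y hΨ)

theorem IsSmooth.contDiffAt_pullback [FiniteDimensional ℝ F] {l : ℕ} {θ : Form E M l}
    (hθ : IsSmooth θ) {Ψ : F → M} {y : F} (hΨ : ContMDiffAt 𝓘(ℝ, F) 𝓘(ℝ, E) ∞ Ψ y) :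
    ContDiffAt ℝ ∞ (F := F [⋀^Fin l]→L[ℝ] ℝ) (pullback (E := F) Ψ θ) y := by
  have hy := mem_chart_source E (Ψ y)
  have hc := contDiffAt_chartAt_comp hΨ hy
  refine ContDiffAt.congr_of_eventuallyEq ?_ (pullback_eventuallyEq_chartRep θ hΨ hy)
  exact contDiffAt_compContinuousLinearMap
    (ContDiffAt.comp y (g := chartRep θ (Ψ y)) (isSmooth_iff.1 hθ _ _ hy) hc)
    (hc.fderiv_right (by simp))

theorem IsSmooth.extDeriv_pullback {l : ℕ} {θ : Form E M l}
    (hθ : IsSmooth θ) {Ψ : F → M} {y : F} (hΨ : ContMDiffAt 𝓘(ℝ, F) 𝓘(ℝ, E) ∞ Ψ y) :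
    extDeriv (pullback (E := F) Ψ θ) y = pullback (E := F) Ψ (extD θ) y := by
  have hy := mem_chart_source E (Ψ y)
  have hc := contDiffAt_chartAt_comp hΨ hy
  have hd := _root_.extDeriv_pullback (f := chartAt E (Ψ y) ∘ Ψ) (hθ.differentiableAt (Ψ y)) hc minSmoothness_two_le
  refine ((pullback_eventuallyEq_chartRep θ hΨ hy).extDeriv_eq).trans (hd.trans ?_)
  rw [← mfderiv_eq_fderiv, mfderiv_comp y (mdifferentiableAt_chartAt hy)
    (hΨ.mdifferentiableAt (by simp))]
  rfl

theorem contMDiffAt_comp_chartAt_symm {E' : Type*} [NormedAddCommGroup E']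
    [NormedSpace ℝ E'] {M' : Type*} [TopologicalSpace M'] [ChartedSpace E' M'] {h : M → M'} {p x₀ : M}
    (hh : ContMDiffAt 𝓘(ℝ, E) 𝓘(ℝ, E') ∞ h p) (hp : p ∈ (chartAt E x₀).source) :
    ContMDiffAt 𝓘(ℝ, E) 𝓘(ℝ, E') ∞ (h ∘ (chartAt E x₀).symm) (chartAt E x₀ p) := by
  refine ContMDiffAt.comp _ ?_ (contMDiffAt_chartAt_symm ((chartAt E x₀).map_source hp))
  rwa [(chartAt E x₀).left_inv hp]

/-- The opposite direction to `pullback_eventuallyEq_chartRep`: here the form on the manifold comes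
from a vector space, as α, β, γ come locally from the coordinates of G_k. -/
theorem chartRep_eventuallyEq {l : ℕ} {α : Form E M l} {h : M → F} {θ : Form F F l}
    {p x₀ : M} (hp : p ∈ (chartAt E x₀).source) (hh : ContMDiffAt 𝓘(ℝ, E) 𝓘(ℝ, F) ∞ h p)
    (hα : α =ᶠ[𝓝 p] pullback (E := E) h θ) :
    chartRep α x₀ =ᶠ[𝓝 (chartAt E x₀ p)] fun y => (θ (h ((chartAt E x₀).symm y))
      ).compContinuousLinearMap (fderiv ℝ (h ∘ (chartAt E x₀).symm) y) := by
  have hc : Tendsto (chartAt E x₀).symm (𝓝 (chartAt E x₀ p)) (𝓝 p) :=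
    (chartAt E x₀).tendsto_symm hp
  filter_upwards [hc.eventually hα, hc.eventually (ContMDiffAt.eventually_mdifferentiableAt hh),
    (chartAt E x₀).open_target.mem_nhds ((chartAt E x₀).map_source hp)] with y h1 h2 h3
  rw [chartRep_eq_pullback, pullback_apply_congr _ h1,
    ← pullback_comp h2 (mdifferentiableAt_chartAt_symm h3)]
  simp only [pullback, mfderiv_eq_fderiv]
  rfl

/-- A form that is locally pulled back from a smooth form on a vector space is smooth. -/
theorem contDiffAt_chartRep_of_eventuallyEq_pullback [FiniteDimensional ℝ E] {l : ℕ} {α : Form E M l}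
    {h : M → F} {θ : Form F F l}
    {p x₀ : M} (hp : p ∈ (chartAt E x₀).source) (hh : ContMDiffAt 𝓘(ℝ, E) 𝓘(ℝ, F) ∞ h p)
    (hθ : ContDiffAt ℝ ∞ (F := F [⋀^Fin l]→L[ℝ] ℝ) θ (h p)) (hα : α =ᶠ[𝓝 p] pullback (E := E) h θ) :
    ContDiffAt ℝ ∞ (chartRep α x₀) (chartAt E x₀ p) := by
  have hc : ContDiffAt ℝ ∞ (h ∘ (chartAt E x₀).symm) (chartAt E x₀ p) :=
    contMDiffAt_iff_contDiffAt.1 (contMDiffAt_comp_chartAt_symm hh hp)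
  refine ContDiffAt.congr_of_eventuallyEq ?_ (chartRep_eventuallyEq hp hh hα)
  refine contDiffAt_compContinuousLinearMap
    (ContDiffAt.comp _ (g := θ) ?_ hc) (hc.fderiv_right (by simp))
  simpa [(chartAt E x₀).left_inv hp] using hθ

theorem extD_of_eventuallyEq_pullback {l : ℕ} {α : Form E M l}
    {h : M → F} {θ : Form F F l} {p : M} (hh : ContMDiffAt 𝓘(ℝ, E) 𝓘(ℝ, F) ∞ h p)
    (hθ : DifferentiableAt ℝ (F := F [⋀^Fin l]→L[ℝ] ℝ) θ (h p)) (hα : α =ᶠ[𝓝 p] pullback (E := E) h θ) :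
    extD α p = pullback (E := E) h (extDeriv θ : Form F F (l + 1)) p := by
  have hp := mem_chart_source E p
  have hl := (chartAt E p).left_inv hp
  have hcm := contMDiffAt_comp_chartAt_symm hh hp
  have hc : ContDiffAt ℝ ∞ (h ∘ (chartAt E p).symm) (chartAt E p p) :=
    contMDiffAt_iff_contDiffAt.1 hcm
  have hd := _root_.extDeriv_pullback (f := h ∘ (chartAt E p).symm)
    (x := chartAt E p p) (by simpa [hl] using hθ) hc minSmoothness_two_le
  have e : h =ᶠ[𝓝 p] (h ∘ (chartAt E p).symm) ∘ chartAt E p := by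
    filter_upwards [(chartAt E p).open_source.mem_nhds hp] with z hz
    simp [(chartAt E p).left_inv hz]
  refine Eq.trans ?_ ((pullback_congr e _).trans (pullback_comp (hcm.mdifferentiableAt (by simp))
    (mdifferentiableAt_chartAt hp) _)).symm
  refine congrArg (fun μ : E [⋀^Fin (l + 1)]→L[ℝ] ℝ => μ.compContinuousLinearMap
    (mfderiv 𝓘(ℝ, E) 𝓘(ℝ, E) (chartAt E p) p : E →L[ℝ] E))
    (((chartRep_eventuallyEq hp hh hα).extDeriv_eq.trans hd).trans ?_)
  simp only [pullback, mfderiv_eq_fderiv]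

theorem extD_wedge {l : ℕ} {w a b : Form E M 1} {θ : Form E M l} (hw : IsSmooth w)
    (hθ : IsSmooth θ) {c : ℝ} (h : extD w = c • wedge a b) :
    extD (wedge w θ) = c • wedge a (wedge b θ) - wedge w (extD θ) := by
  funext p
  have hp := mem_chart_source E p
  have hΨ : ContMDiffAt 𝓘(ℝ, E) 𝓘(ℝ, E) ∞ (chartAt E p).symm (chartAt E p p) :=
    contMDiffAt_chartAt_symm (mem_chart_target E p)
  have h1 := hw.extDeriv_pullback hΨ
  rw [h, pullback_smul, pullback_wedge] at h1
  have h2 := extDeriv_wedgeL (hw.differentiableAt p) (hθ.differentiableAt p) h1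
  rw [← chartRep_wedge] at h2
  have e : (chartAt E p).symm ∘ chartAt E p =ᶠ[𝓝 p] id := by
    filter_upwards [(chartAt E p).open_source.mem_nhds hp] with z hz
    simp [(chartAt E p).left_inv hz]
  -- The differentials of the chart and of its inverse cancel at `p`, so a form read in the chart
  -- and transported back is the original one.
  have back : ∀ {j : ℕ} (μ : Form E M j), (chartRep μ p (chartAt E p p)).compContinuousLinearMap
      (mfderiv 𝓘(ℝ, E) 𝓘(ℝ, E) (chartAt E p) p : E →L[ℝ] E) = μ p := by
    intro j μ
    have := pullback_comp (mdifferentiableAt_chartAt_symm (mem_chart_target E p))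
      (mdifferentiableAt_chartAt hp) μ
    rw [pullback_congr e, pullback_id] at this
    exact this.symm
  have aux : ∀ (A B W : E [⋀^Fin 1]→L[ℝ] ℝ) (T : E [⋀^Fin l]→L[ℝ] ℝ)
      (X : E [⋀^Fin (l + 1)]→L[ℝ] ℝ) (L : E →L[ℝ] E),
      (c • wedgeL E _ A (wedgeL E _ B T) - wedgeL E _ W X).compContinuousLinearMap L =
      c • wedgeL E _ (A.compContinuousLinearMap L)
        (wedgeL E _ (B.compContinuousLinearMap L) (T.compContinuousLinearMap L)) -
      wedgeL E _ (W.compContinuousLinearMap L) (X.compContinuousLinearMap L) := by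
    intro A B W T X L
    rw [← wedgeL_compContinuousLinearMap, ← wedgeL_compContinuousLinearMap,
      ← wedgeL_compContinuousLinearMap]
    rfl
  refine (congrArg (fun μ : E [⋀^Fin (l + 1 + 1)]→L[ℝ] ℝ => μ.compContinuousLinearMap
    (mfderiv 𝓘(ℝ, E) 𝓘(ℝ, E) (chartAt E p) p : E →L[ℝ] E)) h2).trans ((aux _ _ _ _ _ _).trans ?_)
  exact congrArg₂ (· - ·) (congrArg (c • ·) (congrArg₂ (fun u v => wedgeL E _ u v) (back a)
    (congrArg₂ (fun u v => wedgeL E l u v) (back b) (back θ))))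
    (congrArg₂ (fun u v => wedgeL E (l + 1) u v) (back w) rfl)

end Naturality

end ACFM

end

noncomputable section

namespace ACFM

open Filter Topology

/-! ### Structure equations of the invariant forms on G_k. -/

section Invariant

variable {k : ℝ}

/-- An alternating `1`-form from a covector, as a continuous linear map. -/
abbrev ofCovec : (ℝ × ℝ × ℝ →L[ℝ] ℝ) →L[ℝ] ((ℝ × ℝ × ℝ) [⋀^Fin 1]→L[ℝ] ℝ) :=
  ((ContinuousAlternatingMap.ofSubsingletonLIE (𝕜 := ℝ) (E := ℝ × ℝ × ℝ) (F := ℝ)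
    (0 : Fin 1)).toContinuousLinearEquiv : _ →L[ℝ] _)

/-- The forms α, β, γ all have the shape a + r c(g) b with constant covectors a, b, c, so a single
computation gives the three structure equations. -/
theorem hasFDerivAt_ofCovec_add_smul (a c : ℝ × ℝ × ℝ →L[ℝ] ℝ) (b : ℝ × ℝ × ℝ →L[ℝ] ℝ)
    (r : ℝ) (g : ℝ × ℝ × ℝ) :
    HasFDerivAt (fun g => ofCovec (a + (r * c g) • b))
      (r • (covec (ofCovec c)).smulRight (ofCovec b)) g := by
  have h1 : HasFDerivAt (fun g => a + (r * c g) • b) ((r • c).smulRight b) g :=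
    (((c.hasFDerivAt (x := g)).const_mul r).smul_const b).const_add a
  refine (ofCovec.hasFDerivAt.comp g h1).congr_fderiv ?_
  refine ContinuousLinearMap.ext fun v => ?_
  change ofCovec ((r * c v) • b) = r • c v • ofCovec b
  rw [map_smul, mul_smul]

theorem extDeriv_ofCovec_add_smul (a c : ℝ × ℝ × ℝ →L[ℝ] ℝ) (b : ℝ × ℝ × ℝ →L[ℝ] ℝ)
    (r : ℝ) (g : ℝ × ℝ × ℝ) :
    extDeriv (fun g => ofCovec (a + (r * c g) • b)) g =
      r • wedgeL _ 1 (ofCovec c) (ofCovec b) := by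
  rw [extDeriv, (hasFDerivAt_ofCovec_add_smul a c b r g).fderiv,
    ContinuousAlternatingMap.alternatizeUncurryFin_smul, alternatizeUncurryFin_smulRight]

theorem contDiff_ofCovec_add_smul (a c : ℝ × ℝ × ℝ →L[ℝ] ℝ) (b : ℝ × ℝ × ℝ →L[ℝ] ℝ) (r : ℝ) :
    ContDiff ℝ ∞ (fun g => ofCovec (a + (r * c g) • b)) :=
  ofCovec.contDiff.comp (contDiff_const.add ((contDiff_const.mul c.contDiff).smul contDiff_const))

theorem G.alpha_eq : (G.alpha k : ℝ × ℝ × ℝ → (ℝ × ℝ × ℝ) [⋀^Fin 1]→L[ℝ] ℝ) =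
    fun g => ofCovec (G.dx + (-k * G.dx g) • G.dz) := by
  funext g
  have h : ∀ r : ℝ, dx + (-k * r) • dz = dx - (k * r) • dz := fun r => by
    refine ContinuousLinearMap.ext fun v => ?_
    simp [sub_eq_add_neg]
  exact (congrArg ofCovec (h g.x)).symm

theorem G.beta_eq : (G.beta k : ℝ × ℝ × ℝ → (ℝ × ℝ × ℝ) [⋀^Fin 1]→L[ℝ] ℝ) =
    fun g => ofCovec (G.dy + (k * G.dy g) • G.dz) := rfl

theorem G.gamma_eq : (G.gamma k : ℝ × ℝ × ℝ → (ℝ × ℝ × ℝ) [⋀^Fin 1]→L[ℝ] ℝ) =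
    fun g => ofCovec (G.dz + (0 * G.dz g) • G.dz) := by
  funext g
  rw [zero_mul, zero_smul, add_zero]
  rfl

theorem G.contDiff_alpha : ContDiff ℝ ∞ (E := ℝ × ℝ × ℝ) (F := (ℝ × ℝ × ℝ) [⋀^Fin 1]→L[ℝ] ℝ)
    (G.alpha k) := by
  rw [G.alpha_eq]; exact contDiff_ofCovec_add_smul _ _ _ _

theorem G.contDiff_beta : ContDiff ℝ ∞ (E := ℝ × ℝ × ℝ) (F := (ℝ × ℝ × ℝ) [⋀^Fin 1]→L[ℝ] ℝ)
    (G.beta k) := by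
  rw [G.beta_eq]; exact contDiff_ofCovec_add_smul _ _ _ _

theorem G.contDiff_gamma : ContDiff ℝ ∞ (E := ℝ × ℝ × ℝ) (F := (ℝ × ℝ × ℝ) [⋀^Fin 1]→L[ℝ] ℝ)
    (G.gamma k) := by
  rw [G.gamma_eq]; exact contDiff_ofCovec_add_smul _ _ _ _

/-- Direct differentiation gives -k dx∧dz; here dx may be replaced by α because they differ by a
multiple of dz. -/
theorem G.extDeriv_alpha : (extDeriv (E := ℝ × ℝ × ℝ) (G.alpha k) : Form (ℝ × ℝ × ℝ) (G k) 2) =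
    k • wedge (G.gamma k) (G.alpha k) := by
  funext g
  have h : extDeriv (E := ℝ × ℝ × ℝ) (G.alpha k) g =
      (-k) • wedgeL _ 1 (ofCovec G.dx) (ofCovec G.dz) := by
    rw [G.alpha_eq]; exact extDeriv_ofCovec_add_smul _ _ _ _ _
  refine h.trans ?_
  change _ = k • wedgeL _ 1 (ofCovec G.dz) (ofCovec (G.dx - (k * G.x g) • G.dz))
  rw [wedgeL_one_comm, map_sub, map_smul, map_sub, map_smul, wedgeL_one_self]
  simp

theorem G.extDeriv_beta : (extDeriv (E := ℝ × ℝ × ℝ) (G.beta k) : Form (ℝ × ℝ × ℝ) (G k) 2) =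
    (-k) • wedge (G.gamma k) (G.beta k) := by
  funext g
  have h : extDeriv (E := ℝ × ℝ × ℝ) (G.beta k) g =
      k • wedgeL _ 1 (ofCovec G.dy) (ofCovec G.dz) := by
    rw [G.beta_eq]; exact extDeriv_ofCovec_add_smul _ _ _ _ _
  refine h.trans ?_
  change _ = (-k) • wedgeL _ 1 (ofCovec G.dz) (ofCovec (G.dy + (k * G.y g) • G.dz))
  rw [wedgeL_one_comm, map_add, map_smul, map_add, map_smul, wedgeL_one_self,
    smul_zero, add_zero, smul_neg]
  exact (neg_smul k _).symm

/-- Zero is written as a multiple of γ∧γ to fit the hypothesis of `extD_pullback_descend`. -/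
theorem G.extDeriv_gamma : (extDeriv (E := ℝ × ℝ × ℝ) (G.gamma k) : Form (ℝ × ℝ × ℝ) (G k) 2) =
    (0 : ℝ) • wedge (G.gamma k) (G.gamma k) := by
  funext g
  have h : extDeriv (E := ℝ × ℝ × ℝ) (G.gamma k) g =
      (0 : ℝ) • wedgeL _ 1 (ofCovec G.dz) (ofCovec G.dz) := by
    rw [G.gamma_eq]; exact extDeriv_ofCovec_add_smul _ _ _ _ _
  exact h

end Invariant

/-! ### Induced forms on the quotient and their pullbacks. -/

section Descend

variable {k : ℝ} (Γ : Subgroup (G k)) [DiscreteTopology Γ]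

/-- Read in the chart at the image point, the projection is locally a right translation. -/
theorem contMDiff_mk : ContMDiff 𝓘(ℝ, ℝ × ℝ × ℝ) 𝓘(ℝ, ℝ × ℝ × ℝ) ∞
    (QuotientGroup.mk : G k → G k ⧸ Γ) := by
  intro g
  have hf := isLocalHomeomorph_mk Γ
  set q : G k ⧸ Γ := QuotientGroup.mk g with hq
  obtain ⟨c, -, hc⟩ := eventually_localInverseAt_mk Γ q g (mem_chart_source (ℝ × ℝ × ℝ) q).1
  rw [contMDiffAt_iff_target]
  refine ⟨hf.continuous.continuousAt, ?_⟩
  have h1 : ContMDiff 𝓘(ℝ, ℝ × ℝ × ℝ) 𝓘(ℝ, ℝ × ℝ × ℝ) ∞ (M := ℝ × ℝ × ℝ) (M' := ℝ × ℝ × ℝ)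
      (fun h : G k => h * c) := (G.contDiff_mul_right c).contMDiff
  exact (h1 g).congr_of_eventuallyEq hc

variable {E : Type*} [NormedAddCommGroup E] [NormedSpace ℝ E]
  {M : Type*} [TopologicalSpace M] [ChartedSpace E M]

/-- The pullback of an induced form along a map that lifts to `G_k`. -/
theorem pullback_descend_of_lift {l : ℕ} (θ : Form (ℝ × ℝ × ℝ) (G k) l)
    (hθ : ∀ c : G k, pullback (fun g : G k => g * c) θ = θ) {π : M → G k ⧸ Γ} {h : M → G k} {p : M}
    (hπ : π =ᶠ[𝓝 p] QuotientGroup.mk ∘ h)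
    (hh : MDifferentiableAt 𝓘(ℝ, E) 𝓘(ℝ, ℝ × ℝ × ℝ) h p) :
    pullback (E := E) π (descend Γ θ) p = pullback h θ p := by
  rw [pullback_congr hπ, pullback_comp ((contMDiff_mk Γ).mdifferentiableAt (by simp)) hh,
    pullback_descend Γ θ hθ]

theorem contMDiffAt_chartAt_comp {π : M → G k ⧸ Γ}
    (hπ : ContMDiff 𝓘(ℝ, E) 𝓘(ℝ, ℝ × ℝ × ℝ) ∞ π) (p : M) :
    ContMDiffAt 𝓘(ℝ, E) 𝓘(ℝ, ℝ × ℝ × ℝ) ∞ (chartAt (ℝ × ℝ × ℝ) (π p) ∘ π) p :=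
  (contMDiffAt_chartAt (mem_chart_source _ _)).comp p (hπ p)

variable {Γ} in
-- A chart of the quotient is a local lift to G_k, so near `p` the induced form is pulled back from
-- ℝ³ by a smooth map. Smoothness and the exterior derivative are computed from this.
theorem eventuallyEq_pullback_chartAt {π : M → G k ⧸ Γ}
    (hπ : ContMDiff 𝓘(ℝ, E) 𝓘(ℝ, ℝ × ℝ × ℝ) ∞ π) (p : M) {l : ℕ} {θ : Form (ℝ × ℝ × ℝ) (G k) l}
    (hθ : ∀ c : G k, pullback (fun g : G k => g * c) θ = θ) :
    pullback (E := E) π (descend Γ θ) =ᶠ[𝓝 p]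
      pullback (E := E) (M' := ℝ × ℝ × ℝ) (chartAt (ℝ × ℝ × ℝ) (π p) ∘ π) θ := by
  have hs : ∀ᶠ p' in 𝓝 p, π p' ∈ (chartAt (ℝ × ℝ × ℝ) (π p)).source :=
    hπ.continuous.continuousAt.eventually_mem
      ((chartAt (ℝ × ℝ × ℝ) (π p)).open_source.mem_nhds (mem_chart_source _ _))
  filter_upwards [hs, hs.eventually_nhds] with p' h1 h2
  refine pullback_descend_of_lift Γ θ hθ (h := chartAt (ℝ × ℝ × ℝ) (π p) ∘ π) ?_ ?_
  · filter_upwards [h2] with p'' h3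
    exact ((isLocalHomeomorph_mk Γ).apply_localInverseAt_of_mem h3.1).symm
  · exact (mdifferentiableAt_chartAt h1).comp p' (hπ.mdifferentiableAt (by simp))

variable [IsManifold 𝓘(ℝ, E) ∞ M]

theorem isSmooth_pullback_descend [FiniteDimensional ℝ E] {π : M → G k ⧸ Γ}
    (hπ : ContMDiff 𝓘(ℝ, E) 𝓘(ℝ, ℝ × ℝ × ℝ) ∞ π) {l : ℕ} {θ : Form (ℝ × ℝ × ℝ) (G k) l}
    (hθ : ∀ c : G k, pullback (fun g : G k => g * c) θ = θ)
    (hs : ContDiff ℝ ∞ (E := ℝ × ℝ × ℝ) (F := (ℝ × ℝ × ℝ) [⋀^Fin l]→L[ℝ] ℝ) θ) :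
    IsSmooth (pullback (E := E) π (descend Γ θ)) := by
  rw [isSmooth_iff]
  intro x₀ p hp
  exact contDiffAt_chartRep_of_eventuallyEq_pullback hp (contMDiffAt_chartAt_comp Γ hπ p)
    hs.contDiffAt (eventuallyEq_pullback_chartAt hπ p hθ)

theorem extD_pullback_descend {π : M → G k ⧸ Γ}
    (hπ : ContMDiff 𝓘(ℝ, E) 𝓘(ℝ, ℝ × ℝ × ℝ) ∞ π) {θ a b : Form (ℝ × ℝ × ℝ) (G k) 1}
    (hθ : ∀ c : G k, pullback (fun g : G k => g * c) θ = θ)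
    (ha : ∀ c : G k, pullback (fun g : G k => g * c) a = a)
    (hb : ∀ c : G k, pullback (fun g : G k => g * c) b = b)
    (hs : ContDiff ℝ ∞ (E := ℝ × ℝ × ℝ) (F := (ℝ × ℝ × ℝ) [⋀^Fin 1]→L[ℝ] ℝ) θ)
    {c : ℝ} (hd : (extDeriv (E := ℝ × ℝ × ℝ) θ : Form (ℝ × ℝ × ℝ) (G k) 2) = c • wedge a b) :
    extD (pullback (E := E) π (descend Γ θ)) =
      c • wedge (pullback π (descend Γ a)) (pullback π (descend Γ b)) := by
  funext p
  refine (extD_of_eventuallyEq_pullback (contMDiffAt_chartAt_comp Γ hπ p)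
    (hs.contDiffAt.differentiableAt (by simp)) (eventuallyEq_pullback_chartAt hπ p hθ)).trans ?_
  refine (congrArg (fun μ : Form (ℝ × ℝ × ℝ) (G k) 2 => pullback (E := E) (M' := ℝ × ℝ × ℝ)
    (chartAt (ℝ × ℝ × ℝ) (π p) ∘ π) μ p) hd).trans ?_
  have e1 := (eventuallyEq_pullback_chartAt hπ p ha).self_of_nhds
  have e2 := (eventuallyEq_pullback_chartAt hπ p hb).self_of_nhds
  refine (congrArg (c • ·) (congrFun (pullback_wedge (E := E) (M' := ℝ × ℝ × ℝ)
    (chartAt (ℝ × ℝ × ℝ) (π p) ∘ π) a b) p)).trans ?_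
  exact congrArg (c • ·) (congrArg₂ (fun u v => wedgeL E 1 u v) e1.symm e2.symm)

end Descend

end ACFM

end

noncomputable section

namespace ACFM

open MeasureTheory Set

/-! ### A flux estimate for vector fields on ℝ³. -/

section Averaging

/-- The flux of a vector field through the faces of a box, if the field is bounded by `A`, `A`, `C` in
the three coordinate directions. -/
theorem box_volume_le_of_divergence_eq_one {N : Fin 3 → (Fin 3 → ℝ) → ℝ}
    {N' : Fin 3 → (Fin 3 → ℝ) → (Fin 3 → ℝ) →L[ℝ] ℝ} (hN : ∀ i x, HasFDerivAt (N i) (N' i x) x)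
    (hdiv : ∀ x, ∑ i, N' i x (Pi.single i 1) = 1) {l r A C : ℝ} (hl : 0 ≤ l) (hr : 0 ≤ r)
    (h0 : ∀ x, x 2 ∈ Icc 0 r → |N 0 x| ≤ A) (h1 : ∀ x, x 2 ∈ Icc 0 r → |N 1 x| ≤ A)
    (h2 : ∀ x, |N 2 x| ≤ C) : l * l * r ≤ 4 * A * (l * r) + 2 * C * (l * l) := by
  set b : Fin 3 → ℝ := ![l, l, r] with hb
  have hle : (0 : Fin 3 → ℝ) ≤ b := by
    intro i; fin_cases i <;> simp [hb, hl, hr]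
  have hdt := integral_divergence_of_hasFDerivAt_off_countable' (0 : Fin 3 → ℝ) b hle N N' ∅
    countable_empty (fun i => (continuous_iff_continuousAt.2
      fun x => (hN i x).continuousAt).continuousOn) (fun x _ i => hN i x)
    (by
      refine IntegrableOn.congr_fun (f := fun _ => (1 : ℝ)) ?_ (fun x _ => (hdiv x).symm)
        measurableSet_Icc
      exact integrableOn_const (measure_Icc_lt_top.ne))
  have hvol : (∫ x in Icc (0 : Fin 3 → ℝ) b, ∑ i, N' i x (Pi.single i 1)) = l * l * r := by
    simp only [hdiv]
    rw [setIntegral_const, smul_eq_mul, mul_one, measureReal_def, Real.volume_Icc_pi_toReal hle]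
    simp [Fin.prod_univ_three, hb]
  have face : ∀ (i : Fin 3) (c K : ℝ), (∀ x ∈ Icc ((0 : Fin 3 → ℝ) ∘ i.succAbove) (b ∘ i.succAbove),
      |N i (i.insertNth c x)| ≤ K) →
      |∫ x in Icc ((0 : Fin 3 → ℝ) ∘ i.succAbove) (b ∘ i.succAbove), N i (i.insertNth c x)| ≤
        K * ∏ j, b (i.succAbove j) := by
    intro i c K hK
    have hv : volume.real (Icc ((0 : Fin 3 → ℝ) ∘ i.succAbove) (b ∘ i.succAbove)) =
        ∏ j, b (i.succAbove j) := by
      rw [measureReal_def, Real.volume_Icc_pi_toReal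
        (show (0 : Fin 3 → ℝ) ∘ i.succAbove ≤ b ∘ i.succAbove from fun j => hle _)]
      simp
    rw [← hv]
    exact norm_setIntegral_le_of_norm_le_const (f := fun x => N i (i.insertNth c x))
      measure_Icc_lt_top hK
  rw [hvol, Fin.sum_univ_three] at hdt
  have hp0 : ∏ j, b ((0 : Fin 3).succAbove j) = l * r := by
    simp [Fin.prod_univ_two, hb]
  have hp1 : ∏ j, b ((1 : Fin 3).succAbove j) = l * r := by
    simp [Fin.prod_univ_two, hb, Fin.succAbove]
  have hp2 : ∏ j, b ((2 : Fin 3).succAbove j) = l * l := by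
    simp [Fin.prod_univ_two, hb, Fin.succAbove]
  -- On the faces orthogonal to direction 0 or 1 the face coordinates are renumbered, and coordinate
  -- 2 of the box becomes coordinate 1 of the face.
  have f0 : ∀ c, _ := fun c => face 0 c A fun x hx => h0 _ (by
    have e : Fin.insertNth (α := fun _ => ℝ) (0 : Fin 3) c x 2 = x 1 :=
      Fin.insertNth_apply_succAbove (α := fun _ => ℝ) (0 : Fin 3) c x 1
    rw [e]; exact ⟨hx.1 1, hx.2 1⟩)
  have f1 : ∀ c, _ := fun c => face 1 c A fun x hx => h1 _ (by
    have e : Fin.insertNth (α := fun _ => ℝ) (1 : Fin 3) c x 2 = x 1 :=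
      Fin.insertNth_apply_succAbove (α := fun _ => ℝ) (1 : Fin 3) c x 1
    rw [e]; exact ⟨hx.1 1, hx.2 1⟩)
  have f2 : ∀ c, _ := fun c => face 2 c C fun x hx => h2 _
  rw [hp0] at f0
  rw [hp1] at f1
  rw [hp2] at f2
  have a0 := abs_le.1 (f0 (b 0))
  have a0' := abs_le.1 (f0 ((0 : Fin 3 → ℝ) 0))
  have a1 := abs_le.1 (f1 (b 1))
  have a1' := abs_le.1 (f1 ((0 : Fin 3 → ℝ) 1))
  have a2 := abs_le.1 (f2 (b 2))
  have a2' := abs_le.1 (f2 ((0 : Fin 3 → ℝ) 2))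
  rw [hdt]
  linarith [a0.2, a0'.1, a1.2, a1'.1, a2.2, a2'.1]

/-- A vector field on `ℝ³` whose third component is bounded, and whose other components are
bounded by a function of the third coordinate, does not have constant divergence `1`. -/
theorem false_of_divergence_eq_one {N : Fin 3 → (Fin 3 → ℝ) → ℝ}
    {N' : Fin 3 → (Fin 3 → ℝ) → (Fin 3 → ℝ) →L[ℝ] ℝ} (hN : ∀ i x, HasFDerivAt (N i) (N' i x) x)
    (hdiv : ∀ x, ∑ i, N' i x (Pi.single i 1) = 1) {k C : ℝ}
    (h0 : ∀ x, |N 0 x| ≤ C * Real.exp (|k| * |x 2|)) (h1 : ∀ x, |N 1 x| ≤ C * Real.exp (|k| * |x 2|))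
    (h2 : ∀ x, |N 2 x| ≤ C) : False := by
  have hC : 0 ≤ C := (abs_nonneg _).trans (h2 0)
  -- The height comes first, since the side bound A depends on it. With r = 2C + 1 the flux
  -- inequality becomes l² ≤ 4Arl, and the later choice l = 4Ar + 1 makes the right side (l - 1)l.
  set r := 2 * C + 1 with hr
  set A := C * Real.exp (|k| * r) with hA
  have hA0 : 0 ≤ A := by positivity
  have hr0 : 0 ≤ r := by positivity
  have hbd : ∀ x : Fin 3 → ℝ, x 2 ∈ Icc 0 r → C * Real.exp (|k| * |x 2|) ≤ A := by
    intro x hx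
    rw [abs_of_nonneg hx.1, hA]
    gcongr
    exact hx.2
  have key := box_volume_le_of_divergence_eq_one hN hdiv (l := 4 * A * r + 1) (by positivity) hr0
    (fun x hx => (h0 x).trans (hbd x hx)) (fun x hx => (h1 x).trans (hbd x hx)) h2
  set l := 4 * A * r + 1 with hl
  have hl0 : 0 < l := by positivity
  have : l * l * (r - 2 * C) ≤ 4 * A * r * l := by linarith
  rw [hr] at this
  have h3 : l * l ≤ (l - 1) * l := by
    have e : 4 * A * r = l - 1 := by rw [hl]; ring
    rw [← hr, e] at this
    linarith
  nlinarith

end Averaging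

end ACFM

end

noncomputable section

namespace ACFM

open Filter Topology

/-! ### Exponential coordinates on G_k and local parametrizations of the bundle. -/

section Parametrization

variable {k : ℝ}

/-- The coordinates on `G_k` in which `α = e^{kz} du`, `β = e^{-kz} dv`, `γ = dz`. -/
def G.coord (k : ℝ) (x : Fin 3 → ℝ) : G k :=
  (Real.exp (k * x 2) * x 0, Real.exp (-(k * x 2)) * x 1, x 2)

/-- The inverse of `G.coord`. -/
def G.coordInv (g : G k) : Fin 3 → ℝ :=
  ![Real.exp (-(k * g.z)) * g.x, Real.exp (k * g.z) * g.y, g.z]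

theorem G.coord_coordInv (g : G k) : G.coord k (G.coordInv g) = g := by
  refine G.ext ?_ ?_ ?_
  · change Real.exp (k * g.z) * (Real.exp (-(k * g.z)) * g.x) = _
    rw [← mul_assoc, ← Real.exp_add]; simp
  · change Real.exp (-(k * g.z)) * (Real.exp (k * g.z) * g.y) = _
    rw [← mul_assoc, ← Real.exp_add]; simp
  · rfl

theorem G.continuous_coordInv : Continuous (G.coordInv (k := k)) := by
  have hx := G.continuous_x (k := k)
  have hy := G.continuous_y (k := k)
  have hz := G.continuous_z (k := k)
  unfold G.coordInv
  fun_prop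

theorem G.hasFDerivAt_coord (y : (Fin 3 → ℝ) × ℝ) :
    ∃ L : (Fin 3 → ℝ) × ℝ →L[ℝ] ℝ × ℝ × ℝ,
      HasFDerivAt (F := ℝ × ℝ × ℝ) (fun y : (Fin 3 → ℝ) × ℝ => G.coord k y.1) L y ∧
      ∀ v, L v = (Real.exp (k * y.1 2) * v.1 0 + k * v.1 2 * (Real.exp (k * y.1 2) * y.1 0),
        Real.exp (-(k * y.1 2)) * v.1 1 - k * v.1 2 * (Real.exp (-(k * y.1 2)) * y.1 1), v.1 2) := by
  have c : ∀ i : Fin 3, HasFDerivAt (fun y : (Fin 3 → ℝ) × ℝ => y.1 i)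
      ((ContinuousLinearMap.proj i).comp (ContinuousLinearMap.fst ℝ (Fin 3 → ℝ) ℝ)) y := fun i =>
    ((ContinuousLinearMap.proj (R := ℝ) (φ := fun _ : Fin 3 => ℝ) i).comp
      (ContinuousLinearMap.fst ℝ (Fin 3 → ℝ) ℝ)).hasFDerivAt
  have e1 := ((c 2).const_mul k).exp.mul (c 0)
  have e2 := ((c 2).const_mul k).fun_neg.exp.mul (c 1)
  refine ⟨_, e1.prodMk (e2.prodMk (c 2)), fun v => ?_⟩
  refine Prod.ext ?_ (Prod.ext ?_ rfl)
  · simp; ring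
  · simp; ring

theorem G.contDiff_coord : ContDiff ℝ ∞ (F := ℝ × ℝ × ℝ) (G.coord k) := by
  change ContDiff ℝ ∞ (fun x : Fin 3 → ℝ =>
    ((Real.exp (k * x 2) * x 0, Real.exp (-(k * x 2)) * x 1, x 2) : ℝ × ℝ × ℝ))
  fun_prop

theorem G.contMDiff_coord : ContMDiff 𝓘(ℝ, (Fin 3 → ℝ) × ℝ) 𝓘(ℝ, ℝ × ℝ × ℝ) ∞
    (fun y : (Fin 3 → ℝ) × ℝ => G.coord k y.1) := by
  have h : ContDiff ℝ ∞ (F := ℝ × ℝ × ℝ) (fun y : (Fin 3 → ℝ) × ℝ => G.coord k y.1) :=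
    G.contDiff_coord.comp contDiff_fst
  exact h.contMDiff

theorem G.pullback_coord_alpha (y v : (Fin 3 → ℝ) × ℝ) :
    pullback (E := (Fin 3 → ℝ) × ℝ) (fun y : (Fin 3 → ℝ) × ℝ => G.coord k y.1) (G.alpha k) y
      (fun _ => v) = Real.exp (k * y.1 2) * v.1 0 := by
  obtain ⟨L, hL, hv⟩ := G.hasFDerivAt_coord (k := k) y
  have e : mfderiv 𝓘(ℝ, (Fin 3 → ℝ) × ℝ) 𝓘(ℝ, ℝ × ℝ × ℝ)
      (fun y : (Fin 3 → ℝ) × ℝ => G.coord k y.1) y = L := mfderiv_eq_fderiv.trans hL.fderiv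
  change (G.dx - (k * (G.coord k y.1).x) • G.dz) (mfderiv 𝓘(ℝ, (Fin 3 → ℝ) × ℝ) 𝓘(ℝ, ℝ × ℝ × ℝ)
      (fun y : (Fin 3 → ℝ) × ℝ => G.coord k y.1) y v) = _
  rw [e]
  change (L v).1 - (k * (Real.exp (k * y.1 2) * y.1 0)) * (L v).2.2 = _
  rw [hv]
  ring

theorem G.pullback_coord_beta (y v : (Fin 3 → ℝ) × ℝ) :
    pullback (E := (Fin 3 → ℝ) × ℝ) (fun y : (Fin 3 → ℝ) × ℝ => G.coord k y.1) (G.beta k) y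
      (fun _ => v) = Real.exp (-(k * y.1 2)) * v.1 1 := by
  obtain ⟨L, hL, hv⟩ := G.hasFDerivAt_coord (k := k) y
  have e : mfderiv 𝓘(ℝ, (Fin 3 → ℝ) × ℝ) 𝓘(ℝ, ℝ × ℝ × ℝ)
      (fun y : (Fin 3 → ℝ) × ℝ => G.coord k y.1) y = L := mfderiv_eq_fderiv.trans hL.fderiv
  change (G.dy + (k * (G.coord k y.1).y) • G.dz) (mfderiv 𝓘(ℝ, (Fin 3 → ℝ) × ℝ) 𝓘(ℝ, ℝ × ℝ × ℝ)
      (fun y : (Fin 3 → ℝ) × ℝ => G.coord k y.1) y v) = _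
  rw [e]
  change (L v).2.1 + (k * (Real.exp (-(k * y.1 2)) * y.1 1)) * (L v).2.2 = _
  rw [hv]
  ring

theorem G.pullback_coord_gamma (y v : (Fin 3 → ℝ) × ℝ) :
    pullback (E := (Fin 3 → ℝ) × ℝ) (fun y : (Fin 3 → ℝ) × ℝ => G.coord k y.1) (G.gamma k) y
      (fun _ => v) = v.1 2 := by
  obtain ⟨L, hL, hv⟩ := G.hasFDerivAt_coord (k := k) y
  have e : mfderiv 𝓘(ℝ, (Fin 3 → ℝ) × ℝ) 𝓘(ℝ, ℝ × ℝ × ℝ)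
      (fun y : (Fin 3 → ℝ) × ℝ => G.coord k y.1) y = L := mfderiv_eq_fderiv.trans hL.fderiv
  change G.dz (mfderiv 𝓘(ℝ, (Fin 3 → ℝ) × ℝ) 𝓘(ℝ, ℝ × ℝ × ℝ)
      (fun y : (Fin 3 → ℝ) × ℝ => G.coord k y.1) y v) = _
  rw [e]
  change (L v).2.2 = _
  rw [hv]

/-- A local parametrization of the total space over an open set `U` in the coordinates of `G_k`. -/
structure IsLocalParam {Γ : Subgroup (G k)} [DiscreteTopology Γ] {E : Type*}
    [NormedAddCommGroup E] [NormedSpace ℝ E] {M : Type*} [TopologicalSpace M] [ChartedSpace E M]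
    [MulAction Circle M] (π : M → G k ⧸ Γ) (U : Set (Fin 3 → ℝ)) (Φ : (Fin 3 → ℝ) × ℝ → M) :
    Prop where
  isOpen : IsOpen U
  contMDiffAt : ∀ y, y.1 ∈ U → ContMDiffAt 𝓘(ℝ, (Fin 3 → ℝ) × ℝ) 𝓘(ℝ, E) ∞ Φ y
  proj : ∀ y, y.1 ∈ U → π (Φ y) = QuotientGroup.mk (G.coord k y.1)
  smul : ∀ x ∈ U, ∀ t s : ℝ, Circle.exp (2 * Real.pi * s) • Φ (x, t) = Φ (x, t + s)
  exists_eq : ∀ x ∈ U, ∀ p, π p = QuotientGroup.mk (G.coord k x) → ∃ t, p = Φ (x, t)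

variable {Γ : Subgroup (G k)} [DiscreteTopology Γ]
  {E : Type*} [NormedAddCommGroup E] [NormedSpace ℝ E]
  {M : Type*} [TopologicalSpace M] [ChartedSpace E M] [MulAction Circle M] {π : M → G k ⧸ Γ}

/-- An equivariant trivialization is inverted, with its base unrolled by `G.coord` and its circle by
t ↦ exp(2πit). The result need not be injective: it serves only to pull forms back, and `U` is the
full preimage of the base set. -/
theorem IsPrincipalCircleBundle.exists_isLocalParam
    (hπ : IsPrincipalCircleBundle (ℝ × ℝ × ℝ) E π) (x₀ : Fin 3 → ℝ) :
    ∃ U Φ, x₀ ∈ U ∧ IsLocalParam (E := E) π U Φ := by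
  obtain ⟨e, hb, -, hsm, hact⟩ := hπ.locally_trivial (QuotientGroup.mk (G.coord k x₀))
  have hcoord : Continuous (G.coord k) := (G.contDiff_coord (k := k)).continuous
  have hmk : Continuous (QuotientGroup.mk : G k → G k ⧸ Γ) := (isLocalHomeomorph_mk Γ).continuous
  have tgt : ∀ (x : Fin 3 → ℝ) (c : Circle), (QuotientGroup.mk (G.coord k x) : G k ⧸ Γ) ∈ e.baseSet →
      ((QuotientGroup.mk (G.coord k x) : G k ⧸ Γ), c) ∈ e.target := fun x c hx => e.mem_target.2 hx
  refine ⟨{x | (QuotientGroup.mk (G.coord k x) : G k ⧸ Γ) ∈ e.baseSet},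
    fun y => e.toOpenPartialHomeomorph.symm
      (QuotientGroup.mk (G.coord k y.1), Circle.exp (2 * Real.pi * y.2)), hb, ?_⟩
  constructor
  · exact e.open_baseSet.preimage (hmk.comp hcoord)
  · intro y hy
    have h1 : ContMDiffAt 𝓘(ℝ, (Fin 3 → ℝ) × ℝ) 𝓘(ℝ, ℝ × ℝ × ℝ) ∞
        (fun y : (Fin 3 → ℝ) × ℝ => (QuotientGroup.mk (G.coord k y.1) : G k ⧸ Γ)) y :=
      ((contMDiff_mk Γ).comp G.contMDiff_coord) y
    have h2 : ContMDiffAt 𝓘(ℝ, (Fin 3 → ℝ) × ℝ) (𝓡 1) ∞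
        (fun y : (Fin 3 → ℝ) × ℝ => Circle.exp (2 * Real.pi * y.2)) y := by
      have h3 : ContDiff ℝ ∞ (fun y : (Fin 3 → ℝ) × ℝ => 2 * Real.pi * y.2) := by fun_prop
      exact (contMDiff_circleExp.comp h3.contMDiff) y
    have h4 := hsm.contMDiffAt (e.open_target.mem_nhds (tgt y.1 (Circle.exp (2 * Real.pi * y.2)) hy))
    exact h4.comp y (h1.prodMk h2)
  · intro y hy
    exact e.proj_symm_apply (tgt _ _ hy)
  · intro x hx t s
    have ht := tgt x (Circle.exp (2 * Real.pi * t)) hx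
    have h1 := hact (Circle.exp (2 * Real.pi * s)) _ (e.map_target ht)
    rw [e.apply_symm_apply ht, e.proj_symm_apply ht, ← Circle.exp_add] at h1
    have h2 := congrArg e.toOpenPartialHomeomorph.symm h1.2
    have h3 := e.toOpenPartialHomeomorph.left_inv h1.1
    refine (h3.symm.trans h2).trans ?_
    dsimp only
    rw [mul_add, add_comm]
  · intro x hx p hp
    have hs : p ∈ e.source := e.mem_source.2 (by rw [hp]; exact hx)
    obtain ⟨θ, hθ⟩ := Circle.exp_surjective (e p).2
    refine ⟨θ / (2 * Real.pi), ?_⟩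
    have h1 := e.symm_apply_mk_proj hs
    dsimp only
    rw [mul_div_cancel₀ _ (by positivity), hθ, ← hp]
    exact h1.symm

theorem IsPrincipalCircleBundle.surjective (hπ : IsPrincipalCircleBundle (ℝ × ℝ × ℝ) E π) :
    Function.Surjective π := by
  intro q
  obtain ⟨g, rfl⟩ := QuotientGroup.mk_surjective q
  obtain ⟨U, Φ, hU, hΦ⟩ := hπ.exists_isLocalParam (G.coordInv g)
  exact ⟨Φ (G.coordInv g, 0), by rw [hΦ.proj _ hU, G.coord_coordInv]⟩

namespace IsLocalParam

variable {U : Set (Fin 3 → ℝ)} {Φ : (Fin 3 → ℝ) × ℝ → M} {y : (Fin 3 → ℝ) × ℝ}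

theorem eventually_mem (hΦ : IsLocalParam (E := E) π U Φ) (hy : y.1 ∈ U) :
    ∀ᶠ y' in 𝓝 y, y'.1 ∈ U :=
  continuous_fst.continuousAt.eventually_mem (hΦ.isOpen.mem_nhds hy)

theorem periodic (hΦ : IsLocalParam (E := E) π U Φ) {x : Fin 3 → ℝ} (hx : x ∈ U) (t : ℝ) :
    Φ (x, t + 1) = Φ (x, t) := by
  rw [← hΦ.smul x hx, mul_one, Circle.exp_two_pi, one_smul]

theorem pullback_descend (hΦ : IsLocalParam (E := E) π U Φ)
    (hπ : ContMDiff 𝓘(ℝ, E) 𝓘(ℝ, ℝ × ℝ × ℝ) ∞ π) (hy : y.1 ∈ U) {l : ℕ}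
    {θ : Form (ℝ × ℝ × ℝ) (G k) l} (hθ : ∀ c : G k, pullback (fun g : G k => g * c) θ = θ) :
    pullback (E := (Fin 3 → ℝ) × ℝ) Φ (pullback (E := E) π (descend Γ θ)) y =
      pullback (E := (Fin 3 → ℝ) × ℝ) (fun y : (Fin 3 → ℝ) × ℝ => G.coord k y.1) θ y := by
  rw [← pullback_comp (hπ.mdifferentiableAt (by simp))
    ((hΦ.contMDiffAt y hy).mdifferentiableAt (by simp))]
  refine pullback_descend_of_lift Γ θ hθ ?_ (G.contMDiff_coord.mdifferentiableAt (by simp))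
  filter_upwards [hΦ.eventually_mem hy] with y' hy'
  exact hΦ.proj y' hy'

theorem pullback_add_one (hΦ : IsLocalParam (E := E) π U Φ) (hy : y.1 ∈ U) {l : ℕ}
    (ν : Form E M l) :
    pullback (E := (Fin 3 → ℝ) × ℝ) Φ ν (y + (0, 1)) = pullback (E := (Fin 3 → ℝ) × ℝ) Φ ν y := by
  have hy1 : (y + (0, 1)).1 ∈ U := by simpa using hy
  have e : Φ =ᶠ[𝓝 y] Φ ∘ fun y' => y' + (0, 1) := by
    filter_upwards [hΦ.eventually_mem hy] with y' hy'
    have e1 : y' + (0, 1) = (y'.1, y'.2 + 1) := by ext <;> simp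
    rw [Function.comp_apply, e1]
    exact (hΦ.periodic hy' y'.2).symm
  have hd : HasFDerivAt (fun y' : (Fin 3 → ℝ) × ℝ => y' + (0, 1))
    (ContinuousLinearMap.id ℝ ((Fin 3 → ℝ) × ℝ)) y := (hasFDerivAt_id y).add_const _
  have hm : mfderiv 𝓘(ℝ, (Fin 3 → ℝ) × ℝ) 𝓘(ℝ, (Fin 3 → ℝ) × ℝ)
    (fun y' : (Fin 3 → ℝ) × ℝ => y' + (0, 1)) y = ContinuousLinearMap.id ℝ ((Fin 3 → ℝ) × ℝ) :=
    mfderiv_eq_fderiv.trans hd.fderiv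
  refine Eq.symm ((pullback_congr e ν).trans ((pullback_comp
    (f := fun y' : (Fin 3 → ℝ) × ℝ => y' + (0, 1))
    ((hΦ.contMDiffAt _ hy1).mdifferentiableAt (by simp))
    hd.differentiableAt.mdifferentiableAt ν).trans ?_))
  conv_lhs => rw [pullback]
  rw [hm]
  rfl

/-- By equivariance the orbit through `Φ y` is the image under Φ of the line in the fibre
coordinate, so the normalization of η transfers. -/
theorem pullback_connection (hΦ : IsLocalParam (E := E) π U Φ) (hy : y.1 ∈ U) {η : Form E M 1}
    (hη : IsConnectionForm η) :
    pullback (E := (Fin 3 → ℝ) × ℝ) Φ η y (fun _ => (0, 1)) = 1 := by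
  have h := hη.normalized (Φ y)
  have e : (fun t : ℝ => Circle.exp (2 * Real.pi * t) • Φ y) = Φ ∘ fun t : ℝ => y + t • (0, 1) := by
    funext t
    have e1 : y + t • ((0, 1) : (Fin 3 → ℝ) × ℝ) = (y.1, y.2 + t) := by ext <;> simp
    rw [Function.comp_apply, e1]
    exact hΦ.smul y.1 hy _ _
  have hd : HasFDerivAt (fun t : ℝ => y + t • ((0, 1) : (Fin 3 → ℝ) × ℝ))
      ((ContinuousLinearMap.id ℝ ℝ).smulRight ((0, 1) : (Fin 3 → ℝ) × ℝ)) (0 : ℝ) :=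
    ((hasFDerivAt_id (0 : ℝ)).smul_const _).const_add y
  have hm : mfderiv 𝓘(ℝ, ℝ) 𝓘(ℝ, (Fin 3 → ℝ) × ℝ)
    (fun t : ℝ => y + t • ((0, 1) : (Fin 3 → ℝ) × ℝ)) 0 =
      (ContinuousLinearMap.id ℝ ℝ).smulRight ((0, 1) : (Fin 3 → ℝ) × ℝ) :=
    mfderiv_eq_fderiv.trans hd.fderiv
  have h0 : y + (0 : ℝ) • ((0, 1) : (Fin 3 → ℝ) × ℝ) = y := by simp
  rw [e, pullback_comp (by
    rw [h0]; exact (hΦ.contMDiffAt _ hy).mdifferentiableAt (by simp))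
    hd.differentiableAt.mdifferentiableAt] at h
  rw [pullback, hm] at h
  refine Eq.trans ?_ h
  change pullback (E := (Fin 3 → ℝ) × ℝ) Φ η y (fun _ => (0, 1)) =
    pullback (E := (Fin 3 → ℝ) × ℝ) Φ η (y + (0 : ℝ) • ((0, 1) : (Fin 3 → ℝ) × ℝ))
      (fun _ => (1 : ℝ) • ((0, 1) : (Fin 3 → ℝ) × ℝ))
  rw [h0, one_smul]

end IsLocalParam

end Parametrization

end ACFM

end

noncomputable section

namespace ACFM

open Filter Topology MeasureTheory

/-! ### Differentiation under the fibre integral. -/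

section FibreIntegral

theorem continuous_slice {X Y : Type*} [TopologicalSpace X] [TopologicalSpace Y] {U : Set X}
    {g : X × ℝ → Y} (hg : ContinuousOn g {y | y.1 ∈ U}) {x : X} (hx : x ∈ U) :
    Continuous fun t => g (x, t) :=
  continuousOn_univ.1 (hg.comp (Continuous.prodMk_right x).continuousOn (fun _ _ => hx))

/-- Differentiation under the integral sign over the compact interval `[0, 1]`. -/
theorem hasFDerivAt_intervalIntegral_of_contDiffAt {X : Type*} [NormedAddCommGroup X]
    [NormedSpace ℝ X] [FiniteDimensional ℝ X] {U : Set X} (hU : IsOpen U) {f : X × ℝ → ℝ}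
    (hf : ∀ y, y.1 ∈ U → ContDiffAt ℝ ∞ f y) {x₀ : X} (hx : x₀ ∈ U) :
    HasFDerivAt (fun x => ∫ t in (0 : ℝ)..1, f (x, t))
      (∫ t in (0 : ℝ)..1, (fderiv ℝ f (x₀, t)).comp (ContinuousLinearMap.inl ℝ X ℝ)) x₀ := by
  have : ProperSpace X := FiniteDimensional.proper_real X
  obtain ⟨ε, hε, hball⟩ := Metric.isOpen_iff.1 hU x₀ hx
  have hsub : Metric.closedBall x₀ (ε / 2) ⊆ U :=
    (Metric.closedBall_subset_ball (by linarith)).trans hball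
  have hcf : ContinuousOn f {y | y.1 ∈ U} := fun y hy => (hf y hy).continuousAt.continuousWithinAt
  have hcd : ContinuousOn (fun y => (fderiv ℝ f y).comp (ContinuousLinearMap.inl ℝ X ℝ))
      {y | y.1 ∈ U} := fun y hy => by
    have h1 : ContinuousAt (fderiv ℝ f) y :=
      ((hf y hy).fderiv_right (m := ∞) (by simp)).continuousAt
    exact (h1.clm_comp continuousAt_const).continuousWithinAt
  obtain ⟨C, hC⟩ := ((isCompact_closedBall x₀ (ε / 2)).prod
    (isCompact_Icc (a := (0 : ℝ)) (b := 1))).exists_bound_of_continuousOn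
    (hcd.mono fun y hy => hsub hy.1)
  refine intervalIntegral.hasFDerivAt_integral_of_dominated_of_fderiv_le (bound := fun _ => C)
    (F' := fun x t => (fderiv ℝ f (x, t)).comp (ContinuousLinearMap.inl ℝ X ℝ))
    (Metric.ball_mem_nhds x₀ (half_pos hε)) ?_ ?_ ?_ ?_ ?_ ?_
  · filter_upwards [hU.mem_nhds hx] with x hx'
    exact (continuous_slice hcf hx').aestronglyMeasurable
  · exact (continuous_slice hcf hx).intervalIntegrable _ _
  · exact (continuous_slice hcd hx).aestronglyMeasurable
  · refine Eventually.of_forall fun t ht x hx' => hC (x, t) ⟨Metric.ball_subset_closedBall hx', ?_⟩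
    rw [Set.uIoc_of_le zero_le_one] at ht
    exact ⟨ht.1.le, ht.2⟩
  · exact intervalIntegrable_const
  · refine Eventually.of_forall fun t _ x hx' => ?_
    have h1 := ((hf (x, t) (hsub (Metric.ball_subset_closedBall hx'))).differentiableAt
      (by simp)).hasFDerivAt
    exact h1.comp x (hasFDerivAt_prodMk_left x t)

theorem continuous_fderiv_slice {X : Type*} [NormedAddCommGroup X]
    [NormedSpace ℝ X] {U : Set X} {f : X × ℝ → ℝ}
    (hf : ∀ y, y.1 ∈ U → ContDiffAt ℝ ∞ f y) {x₀ : X} (hx : x₀ ∈ U) :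
    Continuous fun t => fderiv ℝ f (x₀, t) := by
  refine continuous_iff_continuousAt.2 fun t => ?_
  have h1 : ContinuousAt (fderiv ℝ f) (x₀, t) :=
    ((hf (x₀, t) hx).fderiv_right (m := ∞) (by simp)).continuousAt
  exact ContinuousAt.comp (f := fun t => (x₀, t)) h1 (by fun_prop)

theorem fderiv_intervalIntegral_apply {X : Type*} [NormedAddCommGroup X]
    [NormedSpace ℝ X] [FiniteDimensional ℝ X] {U : Set X} (hU : IsOpen U) {f : X × ℝ → ℝ}
    (hf : ∀ y, y.1 ∈ U → ContDiffAt ℝ ∞ f y) {x₀ : X} (hx : x₀ ∈ U) (v : X) :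
    fderiv ℝ (fun x => ∫ t in (0 : ℝ)..1, f (x, t)) x₀ v =
      ∫ t in (0 : ℝ)..1, fderiv ℝ f (x₀, t) (v, 0) := by
  rw [(hasFDerivAt_intervalIntegral_of_contDiffAt hU hf hx).fderiv,
    ContinuousLinearMap.intervalIntegral_apply]
  · rfl
  · exact ((continuous_fderiv_slice hf hx).clm_comp continuous_const).intervalIntegrable _ _

end FibreIntegral

/-! ### Evaluation of top-degree forms on a frame. -/

section Frame

/-- The coordinate vectors of `ℝ³ × ℝ`. -/
def frame : Fin 4 → (Fin 3 → ℝ) × ℝ :=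
  ![(Pi.single 0 1, 0), (Pi.single 1 1, 0), (Pi.single 2 1, 0), (0, 1)]

theorem wedgeL_apply_of_eq_zero {E : Type*} [NormedAddCommGroup E] [NormedSpace ℝ E] {l : ℕ}
    (a : E [⋀^Fin 1]→L[ℝ] ℝ) (θ : E [⋀^Fin l]→L[ℝ] ℝ) (v : Fin (l + 1) → E) (j : Fin (l + 1))
    (h : ∀ i ≠ j, a (fun _ => v i) = 0) :
    wedgeL E l a θ v = (-1) ^ (j : ℕ) * (a (fun _ => v j) * θ (j.removeNth v)) := by
  rw [wedgeL_apply, Finset.sum_eq_single j]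
  · intro i _ hi
    rw [h i hi]
    ring
  · intro hj
    exact absurd (Finset.mem_univ j) hj

/-- The weights e^r and e^{-r} cancel, and only the fibre component of the connection form
contributes. -/
theorem wedgeL_frame (a b c d : ((Fin 3 → ℝ) × ℝ) [⋀^Fin 1]→L[ℝ] ℝ) {r : ℝ}
    (ha : ∀ v, a (fun _ => v) = Real.exp r * v.1 0)
    (hb : ∀ v, b (fun _ => v) = Real.exp (-r) * v.1 1)
    (hc : ∀ v, c (fun _ => v) = v.1 2) (hd : d (fun _ => (0, 1)) = 1) :
    wedgeL _ 3 a (wedgeL _ 2 b (wedgeL _ 1 c d)) frame = 1 := by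
  have e : Fin.removeNth 0 (Fin.removeNth 0 (Fin.removeNth 0 frame)) = fun _ => (0, 1) := by
    funext i
    fin_cases i
    rfl
  rw [wedgeL_apply_of_eq_zero a _ _ 0, wedgeL_apply_of_eq_zero b _ _ 0,
    wedgeL_apply_of_eq_zero c _ _ 0, ha, hb, hc, e, hd]
  · simp [frame, Fin.removeNth, ← Real.exp_add]
  · intro i hi
    rw [hc]
    fin_cases i <;> simp_all [frame, Fin.removeNth]
  · intro i hi
    rw [hb]
    fin_cases i <;> simp_all [frame, Fin.removeNth]
  · intro i hi
    rw [ha]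
    fin_cases i <;> simp_all [frame]

/-- Top-degree forms are proportional, so their ratio does not depend on the vectors on which they
are evaluated. Local components thereby become values of one function on the whole of M. -/
theorem alternating_apply_eq_div {E : Type*} [NormedAddCommGroup E] [NormedSpace ℝ E]
    (e : Module.Basis (Fin 4) ℝ E) (ξ V : E [⋀^Fin 4]→L[ℝ] ℝ) (v : Fin 4 → E) (h : V v = 1) :
    ξ v = ξ e / V e := by
  have h1 : ∀ f : E [⋀^Fin 4]→L[ℝ] ℝ, f v = f e * e.det v := fun f =>
    congrArg (fun g : E [⋀^Fin 4]→ₗ[ℝ] ℝ => g v) (f.toAlternatingMap.eq_smul_basis_det e)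
  rw [h1] at h
  have hV : V e ≠ 0 := left_ne_zero_of_mul_eq_one h
  rw [h1, eq_div_iff hV]
  linear_combination ξ e * h

end Frame

/-! ### Averages over the circle fibres. -/

section FibreAverage

variable {k : ℝ} {Γ : Subgroup (G k)} [DiscreteTopology Γ]
  {E : Type*} [NormedAddCommGroup E] [NormedSpace ℝ E]
  {M : Type*} [TopologicalSpace M] [ChartedSpace E M] [MulAction Circle M] {π : M → G k ⧸ Γ}

/-- The average of a function over the fibres of a principal circle bundle. -/
def fibreAverage (hs : Function.Surjective π) (f : M → ℝ) (q : G k ⧸ Γ) : ℝ :=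
  ∫ t in (0 : ℝ)..1, f (Circle.exp (2 * Real.pi * t) • Function.surjInv hs q)

/-- The point chosen in the fibre is `Φ (x, s)` for some s, and shifting by s does not change an
integral over a full period. -/
theorem IsLocalParam.fibreAverage_eq {U : Set (Fin 3 → ℝ)} {Φ : (Fin 3 → ℝ) × ℝ → M}
    (hΦ : IsLocalParam (E := E) π U Φ) (hs : Function.Surjective π) (f : M → ℝ) {x : Fin 3 → ℝ}
    (hx : x ∈ U) :
    fibreAverage hs f (QuotientGroup.mk (G.coord k x)) = ∫ t in (0 : ℝ)..1, f (Φ (x, t)) := by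
  obtain ⟨s, hp⟩ := hΦ.exists_eq x hx _ (Function.surjInv_eq hs (QuotientGroup.mk (G.coord k x)))
  have hper : Function.Periodic (fun t => f (Φ (x, t))) 1 := fun t => by
    simp only [hΦ.periodic hx]
  rw [fibreAverage, hp]
  simp only [hΦ.smul x hx]
  rw [intervalIntegral.integral_comp_add_left (fun t => f (Φ (x, t))) s, add_zero,
    hper.intervalIntegral_add_eq s 0, zero_add]

end FibreAverage

end ACFM

end

noncomputable section

namespace ACFM

open Filter Topology MeasureTheory

/-! ### Non-exactness of the volume form. -/

section Volume

variable {k : ℝ} {Γ : Subgroup (G k)} [DiscreteTopology Γ]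
  {E : Type*} [NormedAddCommGroup E] [NormedSpace ℝ E]
  {M : Type*} [TopologicalSpace M] [ChartedSpace E M] [MulAction Circle M] {π : M → G k ⧸ Γ}
  {η : Form E M 1} {ν : Form E M 3}

/-- The forms `α`, `β`, `γ` on the total space. -/
def baseForm (E : Type*) [NormedAddCommGroup E] [NormedSpace ℝ E] {M : Type*} [TopologicalSpace M]
    [ChartedSpace E M] (π : M → G k ⧸ Γ) : Fin 3 → Form E M 1 :=
  ![pullback π (alphaN Γ), pullback π (betaN Γ), pullback π (gammaN Γ)]

/-- The volume form `α ∧ β ∧ γ ∧ η` on the total space. -/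
def volumeForm (π : M → G k ⧸ Γ) (η : Form E M 1) : Form E M 4 :=
  wedge (baseForm E π 0) (wedge (baseForm E π 1) (wedge (baseForm E π 2) η))

/-- The coefficients of the coordinate forms `du`, `dv`, `dz` in `α`, `β`, `γ`. -/
def weight (k : ℝ) (i : Fin 3) (x : Fin 3 → ℝ) : ℝ :=
  ![Real.exp (k * x 2), Real.exp (-(k * x 2)), 1] i

theorem weight_ne_zero (i : Fin 3) (x : Fin 3 → ℝ) : weight k i x ≠ 0 := by
  fin_cases i <;> simp [weight]

theorem contDiff_weight (i : Fin 3) : ContDiff ℝ ∞ (weight k i) := by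
  fin_cases i
  · change ContDiff ℝ ∞ fun x : Fin 3 → ℝ => Real.exp (k * x 2)
    fun_prop
  · change ContDiff ℝ ∞ fun x : Fin 3 → ℝ => Real.exp (-(k * x 2))
    fun_prop
  · exact contDiff_const

theorem inv_weight_le (i : Fin 3) (x : Fin 3 → ℝ) :
    |(weight k i x)⁻¹| ≤ Real.exp (|k| * |x 2|) := by
  have h := abs_mul k (x 2)
  fin_cases i
  · change |(Real.exp (k * x 2))⁻¹| ≤ _
    rw [← Real.exp_neg, Real.abs_exp, Real.exp_le_exp, ← h]
    exact neg_le_abs _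
  · change |(Real.exp (-(k * x 2)))⁻¹| ≤ _
    rw [← Real.exp_neg, Real.abs_exp, Real.exp_le_exp, ← h, neg_neg]
    exact le_abs_self _
  · change |(1 : ℝ)⁻¹| ≤ _
    rw [inv_one, abs_one]
    exact Real.one_le_exp (by positivity)

namespace IsLocalParam

variable {U : Set (Fin 3 → ℝ)} {Φ : (Fin 3 → ℝ) × ℝ → M} {y : (Fin 3 → ℝ) × ℝ}

theorem pullback_baseForm (hΦ : IsLocalParam (E := E) π U Φ)
    (hπ : ContMDiff 𝓘(ℝ, E) 𝓘(ℝ, ℝ × ℝ × ℝ) ∞ π) (hy : y.1 ∈ U) (i : Fin 3)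
    (v : (Fin 3 → ℝ) × ℝ) :
    pullback (E := (Fin 3 → ℝ) × ℝ) Φ (baseForm E π i) y (fun _ => v) =
      weight k i y.1 * v.1 i := by
  fin_cases i
  · exact (congrArg (fun ξ : ((Fin 3 → ℝ) × ℝ) [⋀^Fin 1]→L[ℝ] ℝ => ξ fun _ => v)
      (hΦ.pullback_descend hπ hy G.alpha_right_invariant)).trans (G.pullback_coord_alpha y v)
  · exact (congrArg (fun ξ : ((Fin 3 → ℝ) × ℝ) [⋀^Fin 1]→L[ℝ] ℝ => ξ fun _ => v)
      (hΦ.pullback_descend hπ hy G.beta_right_invariant)).trans (G.pullback_coord_beta y v)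
  · exact (congrArg (fun ξ : ((Fin 3 → ℝ) × ℝ) [⋀^Fin 1]→L[ℝ] ℝ => ξ fun _ => v)
      (hΦ.pullback_descend hπ hy G.gamma_right_invariant)).trans
      ((G.pullback_coord_gamma y v).trans (one_mul _).symm)

theorem pullback_volumeForm (hΦ : IsLocalParam (E := E) π U Φ)
    (hπ : ContMDiff 𝓘(ℝ, E) 𝓘(ℝ, ℝ × ℝ × ℝ) ∞ π) (hη : IsConnectionForm η) (hy : y.1 ∈ U) :
    pullback (E := (Fin 3 → ℝ) × ℝ) Φ (volumeForm π η) y frame = 1 := by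
  rw [volumeForm, pullback_wedge, pullback_wedge, pullback_wedge]
  exact wedgeL_frame _ _ _ _ (hΦ.pullback_baseForm hπ hy 0) (hΦ.pullback_baseForm hπ hy 1)
    (fun v => (hΦ.pullback_baseForm hπ hy 2 v).trans (one_mul _)) (hΦ.pullback_connection hy hη)

/-- The components of a `3`-form in a local parametrization. -/
def component (Φ : (Fin 3 → ℝ) × ℝ → M) (ν : Form E M 3) (i : Fin 4)
    (y : (Fin 3 → ℝ) × ℝ) : ℝ :=
  pullback (E := (Fin 3 → ℝ) × ℝ) Φ ν y (i.removeNth frame)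

theorem frame_castSucc (i j : Fin 3) : (frame i.castSucc).1 j = if i = j then 1 else 0 := by
  fin_cases i <;> fin_cases j <;> simp [frame]

theorem frame_last_fst : (frame (Fin.last 3)).1 = 0 := rfl

/-- The i-th base form vanishes on every frame vector except the i-th, so exactly one component of ν
survives. -/
theorem pullback_wedge_baseForm (hΦ : IsLocalParam (E := E) π U Φ)
    (hπ : ContMDiff 𝓘(ℝ, E) 𝓘(ℝ, ℝ × ℝ × ℝ) ∞ π) (hy : y.1 ∈ U) (i : Fin 3) :
    pullback (E := (Fin 3 → ℝ) × ℝ) Φ (wedge (baseForm E π i) ν) y frame =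
      weight k i y.1 * ((-1) ^ (i : ℕ) * component Φ ν i.castSucc y) := by
  rw [pullback_wedge]
  refine (wedgeL_apply_of_eq_zero _ _ _ i.castSucc fun j hj => ?_).trans ?_
  · rw [hΦ.pullback_baseForm hπ hy]
    induction j using Fin.lastCases with
    | last => rw [frame_last_fst]; simp
    | cast j => rw [frame_castSucc, if_neg fun h => hj (congrArg _ h), mul_zero]
  · rw [hΦ.pullback_baseForm hπ hy, frame_castSucc, if_pos rfl, mul_one, Fin.val_castSucc,
      component]
    ring

/-- The function on the total space that represents `α ∧ ν`, `β ∧ ν` or `γ ∧ ν` with respect to the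
volume form. -/
def coefficient (e : Module.Basis (Fin 4) ℝ E) (π : M → G k ⧸ Γ) (η : Form E M 1) (ν : Form E M 3)
    (i : Fin 3) (p : M) : ℝ :=
  wedge (baseForm E π i) ν p e / volumeForm π η p e

/-- The left side is defined without reference to Φ; this identity is what glues the components from
different parametrizations. -/
theorem coefficient_eq (hΦ : IsLocalParam (E := E) π U Φ) (e : Module.Basis (Fin 4) ℝ E)
    (hπ : ContMDiff 𝓘(ℝ, E) 𝓘(ℝ, ℝ × ℝ × ℝ) ∞ π) (hη : IsConnectionForm η) (hy : y.1 ∈ U)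
    (i : Fin 3) :
    coefficient e π η ν i (Φ y) =
      weight k i y.1 * ((-1) ^ (i : ℕ) * component Φ ν i.castSucc y) := by
  rw [← hΦ.pullback_wedge_baseForm hπ hy]
  exact (alternating_apply_eq_div e _ _ _ (hΦ.pullback_volumeForm hπ hη hy)).symm

theorem contDiffAt_component [IsManifold 𝓘(ℝ, E) ∞ M] (hΦ : IsLocalParam (E := E) π U Φ)
    (hν : IsSmooth ν) (i : Fin 4) (hy : y.1 ∈ U) : ContDiffAt ℝ ∞ (component Φ ν i) y := by
  have h := hν.contDiffAt_pullback (hΦ.contMDiffAt y hy)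
  exact (ContinuousAlternatingMap.apply ℝ ((Fin 3 → ℝ) × ℝ) ℝ
    (i.removeNth frame)).contDiff.contDiffAt.comp y h

theorem divergence_component [IsManifold 𝓘(ℝ, E) ∞ M] (hΦ : IsLocalParam (E := E) π U Φ)
    (hπ : ContMDiff 𝓘(ℝ, E) 𝓘(ℝ, ℝ × ℝ × ℝ) ∞ π) (hη : IsConnectionForm η)
    (hν : IsSmooth ν) (hd : extD ν = volumeForm π η) (hy : y.1 ∈ U) :
    ∑ i : Fin 4, (-1) ^ (i : ℕ) * fderiv ℝ (component Φ ν i) y (frame i) = 1 := by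
  have h1 := hν.extDeriv_pullback (hΦ.contMDiffAt y hy)
  rw [hd] at h1
  have h2 := extDeriv_apply
    ((hν.contDiffAt_pullback (hΦ.contMDiffAt y hy)).differentiableAt (by simp)) frame
  have h3 := (congrArg (fun ξ : ((Fin 3 → ℝ) × ℝ) [⋀^Fin 4]→L[ℝ] ℝ => ξ frame) h1).trans
    (hΦ.pullback_volumeForm hπ hη hy)
  refine Eq.trans ?_ (h2.symm.trans h3)
  refine Finset.sum_congr rfl fun i _ => ?_
  rw [zsmul_eq_mul]
  push_cast
  rfl

theorem component_add_one (hΦ : IsLocalParam (E := E) π U Φ) {x : Fin 3 → ℝ} (hx : x ∈ U) (t : ℝ)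
    (i : Fin 4) : component Φ ν i (x, t + 1) = component Φ ν i (x, t) := by
  have h := hΦ.pullback_add_one (y := (x, t)) hx ν
  have e : ((x, t) : (Fin 3 → ℝ) × ℝ) + (0, 1) = (x, t + 1) := by simp
  rw [e] at h
  exact congrArg (fun ξ : ((Fin 3 → ℝ) × ℝ) [⋀^Fin 3]→L[ℝ] ℝ => ξ (i.removeNth frame)) h

/-- Fibre integral of `divergence_component`: the derivative along the fibre integrates to zero by
periodicity, leaving a divergence in the three base directions. -/
theorem sum_integral_component [IsManifold 𝓘(ℝ, E) ∞ M] (hΦ : IsLocalParam (E := E) π U Φ)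
    (hπ : ContMDiff 𝓘(ℝ, E) 𝓘(ℝ, ℝ × ℝ × ℝ) ∞ π) (hη : IsConnectionForm η)
    (hν : IsSmooth ν) (hd : extD ν = volumeForm π η) {x : Fin 3 → ℝ} (hx : x ∈ U) :
    ∑ i : Fin 3, (-1) ^ (i : ℕ) *
      ∫ t in (0 : ℝ)..1, fderiv ℝ (component Φ ν i.castSucc) (x, t) (Pi.single i 1, 0) = 1 := by
  have hc : ∀ i : Fin 4, Continuous fun t => fderiv ℝ (component Φ ν i) (x, t) (frame i) :=
    fun i => (continuous_fderiv_slice (fun y hy => hΦ.contDiffAt_component hν i hy) hx).clm_apply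
      continuous_const
  have h1 : ∫ t in (0 : ℝ)..1, ∑ i : Fin 4,
      (-1) ^ (i : ℕ) * fderiv ℝ (component Φ ν i) (x, t) (frame i) = 1 := by
    rw [intervalIntegral.integral_congr (g := fun _ => (1 : ℝ)) fun t _ =>
      hΦ.divergence_component hπ hη hν hd (y := (x, t)) hx]
    simp
  have hi : ∀ i : Fin 4, IntervalIntegrable (fun t => (-1) ^ (i : ℕ) *
      fderiv ℝ (component Φ ν i) (x, t) (frame i)) volume 0 1 := fun i =>
    (continuous_const.mul (hc i)).intervalIntegrable _ _
  rw [intervalIntegral.integral_finsetSum fun i _ => hi i, Fin.sum_univ_castSucc] at h1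
  have h2 : ∫ t in (0 : ℝ)..1, fderiv ℝ (component Φ ν (Fin.last 3)) (x, t)
      (frame (Fin.last 3)) = 0 := by
    rw [intervalIntegral.integral_eq_sub_of_hasDerivAt
      (f := fun t => component Φ ν (Fin.last 3) (x, t)) (fun t _ => ?_)
      ((hc _).intervalIntegrable _ _)]
    · have := hΦ.component_add_one (ν := ν) hx 0 (Fin.last 3)
      rw [zero_add] at this
      rw [this, sub_self]
    · have h3 := ((hΦ.contDiffAt_component hν (Fin.last 3) (y := (x, t)) hx).differentiableAt
        (by simp)).hasFDerivAt
      exact h3.comp_hasDerivAt t ((hasDerivAt_const t x).prodMk (hasDerivAt_id t))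
  simp only [intervalIntegral.integral_const_mul] at h1
  rw [h2, mul_zero, add_zero] at h1
  refine Eq.trans (Finset.sum_congr rfl fun i _ => ?_) h1
  have e : ((Pi.single i 1, 0) : (Fin 3 → ℝ) × ℝ) = frame i.castSucc := by
    fin_cases i <;> rfl
  rw [e, Fin.val_castSucc]

end IsLocalParam

open IsLocalParam

/-- The fibre integrals of the components of a `3`-form, in the coordinates of `G_k`. -/
def averageField (e : Module.Basis (Fin 4) ℝ E) (hs : Function.Surjective π) (η : Form E M 1)
    (ν : Form E M 3) (i : Fin 3) (x : Fin 3 → ℝ) : ℝ :=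
  (weight k i x)⁻¹ *
    fibreAverage hs (coefficient e π η ν i) (QuotientGroup.mk (G.coord k x))

/-- The weight in the global definition cancels the one in `coefficient_eq`; differentiability can
therefore be checked locally on a plain fibre integral. -/
theorem IsLocalParam.averageField_eq {U : Set (Fin 3 → ℝ)} {Φ : (Fin 3 → ℝ) × ℝ → M}
    (hΦ : IsLocalParam (E := E) π U Φ) (e : Module.Basis (Fin 4) ℝ E)
    (hs : Function.Surjective π) (hπ : ContMDiff 𝓘(ℝ, E) 𝓘(ℝ, ℝ × ℝ × ℝ) ∞ π)
    (hη : IsConnectionForm η) {x : Fin 3 → ℝ} (hx : x ∈ U) (i : Fin 3) :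
    averageField e hs η ν i x =
      (-1) ^ (i : ℕ) * ∫ t in (0 : ℝ)..1, component Φ ν i.castSucc (x, t) := by
  rw [averageField, hΦ.fibreAverage_eq hs _ hx]
  simp only [hΦ.coefficient_eq (y := (x, _)) e hπ hη hx]
  rw [intervalIntegral.integral_const_mul, intervalIntegral.integral_const_mul,
    inv_mul_cancel_left₀ (weight_ne_zero i x)]

variable [IsManifold 𝓘(ℝ, E) ∞ M]

theorem IsLocalParam.hasFDerivAt_averageField {U : Set (Fin 3 → ℝ)} {Φ : (Fin 3 → ℝ) × ℝ → M}
    (hΦ : IsLocalParam (E := E) π U Φ) (e : Module.Basis (Fin 4) ℝ E)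
    (hs : Function.Surjective π) (hπ : ContMDiff 𝓘(ℝ, E) 𝓘(ℝ, ℝ × ℝ × ℝ) ∞ π)
    (hη : IsConnectionForm η) (hν : IsSmooth ν) {x : Fin 3 → ℝ} (hx : x ∈ U) (i : Fin 3) :
    HasFDerivAt (averageField e hs η ν i) ((-1 : ℝ) ^ (i : ℕ) •
      fderiv ℝ (fun x => ∫ t in (0 : ℝ)..1, component Φ ν i.castSucc (x, t)) x) x := by
  have h := hasFDerivAt_intervalIntegral_of_contDiffAt hΦ.isOpen
    (fun y hy => hΦ.contDiffAt_component hν i.castSucc hy) hx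
  refine (h.differentiableAt.hasFDerivAt.const_mul ((-1 : ℝ) ^ (i : ℕ))).congr_of_eventuallyEq ?_
  filter_upwards [hΦ.isOpen.mem_nhds hx] with x' hx'
  exact hΦ.averageField_eq e hs hπ hη hx' i

/-- The volume form `α ∧ β ∧ γ ∧ η` is not exact. -/
theorem extD_ne_volumeForm [CompactSpace (G k ⧸ Γ)] (e : Module.Basis (Fin 4) ℝ E)
    (hπ : IsPrincipalCircleBundle (ℝ × ℝ × ℝ) E π) (hη : IsConnectionForm η) (hν : IsSmooth ν) :
    extD ν ≠ volumeForm π η := by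
  intro hd
  have hs := hπ.surjective
  have hdiff : ∀ i x, DifferentiableAt ℝ (averageField e hs η ν i) x := fun i x => by
    obtain ⟨U, Φ, hU, hΦ⟩ := hπ.exists_isLocalParam x
    exact (hΦ.hasFDerivAt_averageField e hs hπ.smooth_proj hη hν hU i).differentiableAt
  have hdiv : ∀ x, ∑ i, fderiv ℝ (averageField e hs η ν i) x (Pi.single i 1) = 1 := fun x => by
    obtain ⟨U, Φ, hU, hΦ⟩ := hπ.exists_isLocalParam x
    refine Eq.trans (Finset.sum_congr rfl fun i _ => ?_)
      (hΦ.sum_integral_component hπ.smooth_proj hη hν hd hU)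
    rw [(hΦ.hasFDerivAt_averageField e hs hπ.smooth_proj hη hν hU i).fderiv,
      ← fderiv_intervalIntegral_apply hΦ.isOpen
        (fun y hy => hΦ.contDiffAt_component hν i.castSucc hy) hU]
    rfl
  -- Continuity on the quotient is tested on G_k, where the average is the weight times a
  -- differentiable field in the global coordinates.
  have hcont : ∀ i, Continuous (fibreAverage hs (coefficient e π η ν i)) := fun i => by
    rw [(QuotientGroup.isQuotientMap_mk Γ).continuous_iff]
    have h1 : Continuous fun x => weight k i x * averageField e hs η ν i x :=
      (contDiff_weight i).continuous.mul
        (continuous_iff_continuousAt.2 fun x => (hdiff i x).continuousAt)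
    refine (h1.comp G.continuous_coordInv).congr fun g => ?_
    simp only [Function.comp_apply, averageField]
    rw [mul_inv_cancel_left₀ (weight_ne_zero i _), G.coord_coordInv]
  -- Compactness of the quotient enters here and supplies the bounds for the flux estimate.
  have hbd : ∀ i, ∃ C, ∀ q, |fibreAverage hs (coefficient e π η ν i) q| ≤ C := fun i => by
    obtain ⟨C, hC⟩ := isCompact_univ.exists_bound_of_continuousOn (hcont i).continuousOn
    exact ⟨C, fun q => hC q (Set.mem_univ q)⟩
  choose C hC using hbd
  set K := ∑ i, C i with hK
  have hC0 : ∀ i, 0 ≤ C i := fun i => (abs_nonneg _).trans (hC i (QuotientGroup.mk 1))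
  have hCK : ∀ i, C i ≤ K := fun i => Finset.single_le_sum (fun j _ => hC0 j) (Finset.mem_univ i)
  have hK' : ∀ i q, |fibreAverage hs (coefficient e π η ν i) q| ≤ K := fun i q =>
    (hC i q).trans (hCK i)
  have hN : ∀ i x, |averageField e hs η ν i x| ≤ K * Real.exp (|k| * |x 2|) := fun i x => by
    rw [averageField, abs_mul, mul_comm]
    exact mul_le_mul (hK' i _) (inv_weight_le i x) (abs_nonneg _) ((hC0 i).trans (hCK i))
  refine false_of_divergence_eq_one (fun i x => (hdiff i x).hasFDerivAt) hdiv (hN 0) (hN 1)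
    fun x => ?_
  -- In the z direction the weight is 1, so the bound has no exponential factor, as the flux
  -- estimate requires.
  have h2 : weight k 2 x = 1 := rfl
  rw [averageField, h2, inv_one, one_mul]
  exact hK' 2 _

end Volume

end ACFM

end

noncomputable section

namespace ACFM

/-! ### Algebraic rules for the wedge product of forms. -/

section WedgeAlgebra

variable {E M : Type*} [NormedAddCommGroup E] [NormedSpace ℝ E] {l : ℕ}

theorem wedge_comm (a b : Form E M 1) (θ : Form E M l) :
    wedge a (wedge b θ) = -wedge b (wedge a θ) :=
  funext fun _ => wedgeL_comm _ _ _

theorem wedge_wedge_self (a : Form E M 1) (θ : Form E M l) : wedge a (wedge a θ) = 0 :=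
  funext fun _ => wedgeL_self _ _

theorem wedge_one_comm (a b : Form E M 1) : wedge a b = -wedge b a :=
  funext fun _ => wedgeL_one_comm _ _

theorem wedge_one_self (a : Form E M 1) : wedge a a = 0 :=
  funext fun _ => wedgeL_one_self _

theorem wedge_zero (a : Form E M 1) : wedge a (0 : Form E M l) = 0 := by
  simpa using wedge_smul a 0 (0 : Form E M l)

theorem wedge_neg (a : Form E M 1) (θ : Form E M l) : wedge a (-θ) = -wedge a θ := by
  simpa using wedge_smul a (-1) θ

theorem smul_wedge (r : ℝ) (a : Form E M 1) (θ : Form E M l) :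
    wedge (r • a) θ = r • wedge a θ := by
  funext x
  have h := (wedgeL E l).map_smul r (a x)
  exact congrArg (fun L => L (θ x)) h

end WedgeAlgebra

/-! ### Lichnerowicz classes deduced from non-exactness of the volume form. -/

section Lichnerowicz

variable {E : Type*} [NormedAddCommGroup E] [NormedSpace ℝ E]
  {M : Type*} [TopologicalSpace M] [ChartedSpace E M] {l : ℕ}

theorem mem_closedForms_iff {w : Form E M 1} {θ : Form E M l} :
    θ ∈ closedForms w l ↔ IsSmooth θ ∧ extD θ + wedge w θ = 0 := by
  constructor
  · rintro ⟨θ, h, rfl⟩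
    exact ⟨θ.2, h⟩
  · rintro ⟨h, h'⟩
    exact ⟨⟨θ, h⟩, h', rfl⟩

theorem mem_exactForms_succ_iff {w : Form E M 1} {θ : Form E M (l + 1)} :
    θ ∈ exactForms w (l + 1) ↔ ∃ μ : Form E M l, IsSmooth μ ∧ extD μ + wedge w μ = θ := by
  constructor
  · rintro ⟨μ, h⟩
    exact ⟨μ.1, μ.2, h⟩
  · rintro ⟨μ, h, h'⟩
    exact ⟨⟨μ, h⟩, h'⟩

/-- One class has to serve both for non-vanishing and for the whole family Ω, hence the bundled
conclusion. Since ρ is assumed closed as well as exact, d_w² = 0 is not needed. -/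
theorem exists_ne_zero_represents {w : Form E M 1} {θ : Form E M l} (h : θ ∈ closedForms w l)
    (h' : θ ∉ exactForms w l) : ∃ c : LichCohomology w l, c ≠ 0 ∧ Represents w θ c ∧
      ∀ (t : ℝ) (ρ : Form E M l), ρ ∈ closedForms w l → ρ ∈ exactForms w l →
        Represents w (t • θ + ρ) (t • c) := by
  refine ⟨Submodule.Quotient.mk ⟨θ, h⟩, ?_, ⟨h, rfl⟩, fun t ρ hρ hρ' => ?_⟩
  · rw [Ne, Submodule.Quotient.mk_eq_zero]
    exact h'
  · refine ⟨add_mem (Submodule.smul_mem _ t h) hρ, ?_⟩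
    rw [← Submodule.Quotient.mk_smul, Submodule.Quotient.eq]
    change t • θ - (t • θ + ρ) ∈ exactForms w l
    rw [sub_add_cancel_left]
    exact neg_mem hρ'

theorem extD_neg {θ : Form E M l} : extD (-θ) = -extD θ := by
  simpa using extD_smul (-1) θ

theorem IsSmooth.neg {θ : Form E M l} (h : IsSmooth θ) : IsSmooth (-θ) :=
  (smoothForms E M l).neg_mem h

variable [IsManifold 𝓘(ℝ, E) ∞ M]

/-- The wedge product with a `1`-form `b` with `db = c γ ∧ b` shifts the twist of the Lichnerowicz
differential. -/
theorem extD_wedge_add {b γ : Form E M 1} {μ : Form E M l} {θ : Form E M (l + 1)} {c e : ℝ}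
    (hb : IsSmooth b) (hμ : IsSmooth μ) (hdb : extD b = c • wedge γ b)
    (h : extD μ + e • wedge γ μ = θ) :
    extD (wedge b μ) + (e - c) • wedge γ (wedge b μ) = -wedge b θ := by
  rw [extD_wedge hb hμ hdb, ← h, wedge_add, wedge_smul, wedge_comm b γ]
  module

/-- When the twist equals that of `b`, wedging with `b` turns a twisted primitive into an ordinary
one. -/
theorem extD_wedge_of_twist_eq {b γ : Form E M 1} {μ : Form E M l} {θ : Form E M (l + 1)} {c : ℝ}
    (hb : IsSmooth b) (hμ : IsSmooth μ) (hdb : extD b = c • wedge γ b)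
    (h : extD μ + c • wedge γ μ = θ) : extD (wedge b μ) = -wedge b θ := by
  rw [← extD_wedge_add hb hμ hdb h, sub_self, zero_smul, add_zero]

theorem extD_wedge_of_closed {b : Form E M 1} {μ : Form E M l} (hb : IsSmooth b)
    (hμ : IsSmooth μ) (hdb : extD b = 0) : extD (wedge b μ) = -wedge b (extD μ) := by
  rw [extD_wedge (c := 0) (a := b) (b := b) hb hμ (by rw [hdb, zero_smul]), zero_smul, zero_sub]

/-- Stated for abstract forms so that it applies to (α, β, k, nλ) and to (β, α, -k, -nλ). In each
degree a twisted primitive μ is wedged with b, and then with γ and η as the degree requires, to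
contradict `hvol`. -/
theorem lichnerowicz_classes {a b γ η w : Form E M 1} {κ c : ℝ} (hκ : κ ≠ 0)
    (sa : IsSmooth a) (sb : IsSmooth b) (sγ : IsSmooth γ) (sη : IsSmooth η)
    (ha : extD a = κ • wedge γ a) (hb : extD b = (-κ) • wedge γ b) (hγ : extD γ = 0)
    (hη : extD η = c • wedge a b) (hw : w = (-κ) • γ)
    (hvol : ∀ ν : Form E M 3, IsSmooth ν → extD ν ≠ wedge a (wedge b (wedge γ η))) :
    (∃ C : LichCohomology w 1, C ≠ 0 ∧ Represents w a C) ∧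
    (∃ C : LichCohomology w 2, C ≠ 0 ∧ Represents w (wedge a η) C ∧
      ∀ t₁ t₂ t₃ : ℝ, Represents w
        (t₁ • wedge a η + t₂ • wedge b γ + t₃ • (c • wedge a b - κ • wedge γ η)) (t₁ • C)) ∧
    (∃ C : LichCohomology w 3, C ≠ 0 ∧ Represents w (wedge a (wedge γ η)) C) := by
  subst hw
  have dγη : extD (wedge γ η) = -(c • wedge γ (wedge a b)) := by
    rw [extD_wedge_of_closed sγ sη hγ, hη, wedge_smul]
  refine ⟨?_, ?_, ?_⟩
  · have hcl : a ∈ closedForms ((-κ) • γ) 1 :=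
      mem_closedForms_iff.2 ⟨sa, by rw [ha, smul_wedge]; module⟩
    obtain ⟨C, h0, hC, -⟩ := exists_ne_zero_represents hcl fun hex => by
      obtain ⟨μ, sμ, hμ⟩ := mem_exactForms_succ_iff.1 hex
      rw [smul_wedge] at hμ
      have h1 := extD_wedge_of_twist_eq sb sμ hb hμ
      have h2 := extD_wedge_of_closed sγ (sb.wedge sμ) hγ
      have h3 := extD_wedge sη (sγ.wedge (sb.wedge sμ)) hη
      -- The term from dη = c a∧b contains b twice, so η acts here as if it were closed.
      have h4 : wedge b (wedge γ (wedge b μ)) = 0 := by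
        rw [wedge_comm b γ, wedge_wedge_self, wedge_zero, neg_zero]
      rw [h2, h1, h4, wedge_zero, smul_zero, zero_sub] at h3
      refine hvol (-wedge η (wedge γ (wedge b μ))) (sη.wedge (sγ.wedge (sb.wedge sμ))).neg ?_
      rw [extD_neg, h3]
      simp only [wedge_comm η γ, wedge_comm η b, wedge_one_comm η a, wedge_comm γ b,
        wedge_comm γ a, wedge_comm b a, wedge_neg, neg_neg]
    exact ⟨C, h0, hC⟩
  · have hcl : wedge a η ∈ closedForms ((-κ) • γ) 2 :=
      mem_closedForms_iff.2 ⟨sa.wedge sη, by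
        rw [extD_wedge sa sη ha, hη, smul_wedge, wedge_smul, wedge_wedge_self]; module⟩
    obtain ⟨C, h0, hC, hadd⟩ := exists_ne_zero_represents hcl fun hex => by
      obtain ⟨μ, sμ, hμ⟩ := mem_exactForms_succ_iff.1 hex
      rw [smul_wedge] at hμ
      have h1 := extD_wedge_of_twist_eq sb sμ hb hμ
      have h2 := extD_wedge_of_closed sγ (sb.wedge sμ) hγ
      rw [h1] at h2
      refine hvol (-wedge γ (wedge b μ)) (sγ.wedge (sb.wedge sμ)).neg ?_
      rw [extD_neg, h2]
      simp only [wedge_comm γ b, wedge_comm γ a, wedge_comm b a, wedge_neg, neg_neg]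
    refine ⟨C, h0, hC, fun t₁ t₂ t₃ => ?_⟩
    -- The structure equation and the twist contribute equally: d_w b = -2κ γ∧b = 2κ b∧γ.
    have hbγ : wedge b γ ∈ exactForms ((-κ) • γ) 2 := mem_exactForms_succ_iff.2
      ⟨(2 * κ)⁻¹ • b, (smoothForms E M 1).smul_mem _ sb, by
        rw [extD_smul, hb, smul_wedge, wedge_smul, wedge_one_comm γ b]
        match_scalars
        field_simp
        ring⟩
    -- This form is d_w η.
    have hΩ : c • wedge a b - κ • wedge γ η ∈ exactForms ((-κ) • γ) 2 :=
      mem_exactForms_succ_iff.2 ⟨η, sη, by rw [hη, smul_wedge]; module⟩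
    have cbγ : wedge b γ ∈ closedForms ((-κ) • γ) 2 := mem_closedForms_iff.2 ⟨sb.wedge sγ, by
      rw [extD_wedge sb sγ hb, hγ, smul_wedge, wedge_zero, wedge_comm γ b, wedge_one_self, wedge_zero]
      simp⟩
    have cΩ : c • wedge a b - κ • wedge γ η ∈ closedForms ((-κ) • γ) 2 := by
      have s1 : IsSmooth (c • wedge a b) := (smoothForms E M 2).smul_mem c (sa.wedge sb)
      have s2 : IsSmooth ((-κ) • wedge γ η) := (smoothForms E M 2).smul_mem _ (sγ.wedge sη)
      have e : c • wedge a b - κ • wedge γ η = c • wedge a b + (-κ) • wedge γ η := by module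
      rw [e]
      refine mem_closedForms_iff.2 ⟨(smoothForms E M 2).add_mem s1 s2, ?_⟩
      rw [extD_add s1 s2, extD_smul, extD_smul, extD_wedge sa sb ha, hb, dγη, wedge_add, smul_wedge,
        smul_wedge, wedge_smul, wedge_smul, wedge_smul, wedge_wedge_self, wedge_comm a γ]
      module
    rw [add_assoc]
    exact hadd t₁ _ (add_mem (Submodule.smul_mem _ _ cbγ) (Submodule.smul_mem _ _ cΩ))
      (add_mem (Submodule.smul_mem _ _ hbγ) (Submodule.smul_mem _ _ hΩ))
  · have hcl : wedge a (wedge γ η) ∈ closedForms ((-κ) • γ) 3 :=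
      mem_closedForms_iff.2 ⟨sa.wedge (sγ.wedge sη), by
        rw [extD_wedge sa (sγ.wedge sη) ha, dγη, smul_wedge, wedge_neg, wedge_smul,
          wedge_comm γ a, wedge_wedge_self, wedge_zero, wedge_comm γ a b, wedge_neg,
          wedge_wedge_self]
        simp⟩
    obtain ⟨C, h0, hC, -⟩ := exists_ne_zero_represents hcl fun hex => by
      obtain ⟨μ, sμ, hμ⟩ := mem_exactForms_succ_iff.1 hex
      rw [smul_wedge] at hμ
      have h1 := extD_wedge_of_twist_eq sb sμ hb hμ
      rw [wedge_comm b a, neg_neg] at h1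
      exact hvol _ (sb.wedge sμ) h1
    exact ⟨C, h0, hC⟩

end Lichnerowicz

end ACFM

end

/-! ### The theorem for ω and, by symmetry, for -ω. -/

open ACFM in
theorem theorem3
    (k : ℝ) (hk : ∃ m : ℤ, m ≠ 2 ∧ Real.exp k + Real.exp (-k) = m)
    (Γ : Subgroup (G k)) [DiscreteTopology Γ] [CompactSpace (G k ⧸ Γ)]
    (n : ℤ) (hn : n ≠ 0) (lam : ℝ)
    {M : Type*} [TopologicalSpace M] [T2Space M] [SecondCountableTopology M]
    [ChartedSpace (EuclideanSpace ℝ (Fin 4)) M] [IsManifold (𝓡 4) ∞ M] [MulAction Circle M]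
    (π : M → G k ⧸ Γ)
    (hπ : IsPrincipalCircleBundle (ℝ × ℝ × ℝ) (EuclideanSpace ℝ (Fin 4)) π)
    (α β γ η w : Form (EuclideanSpace ℝ (Fin 4)) M 1)
    (hα : α = pullback π (alphaN Γ)) (hβ : β = pullback π (betaN Γ))
    (hγ : γ = pullback π (gammaN Γ))
    (hη : IsConnectionForm η) (hcurv : extD η = (n * lam) • wedge α β)
    (hw : w = -k • γ) :
    (∃ c : LichCohomology w 1, c ≠ 0 ∧ Represents w α c) ∧
    (∃ c : LichCohomology w 2, c ≠ 0 ∧ Represents w (wedge α η) c ∧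
      ∀ t₁ t₂ t₃ : ℝ, Represents w
        (t₁ • wedge α η + t₂ • wedge β γ + t₃ • ((n * lam) • wedge α β - k • wedge γ η))
        (t₁ • c)) ∧
    (∃ c : LichCohomology w 3, c ≠ 0 ∧ Represents w (wedge α (wedge γ η)) c) ∧
    (∃ c : LichCohomology (-w) 1, c ≠ 0 ∧ Represents (-w) β c) ∧
    (∃ c : LichCohomology (-w) 2, c ≠ 0 ∧ Represents (-w) (wedge β η) c ∧
      ∀ s₁ s₂ s₃ : ℝ, Represents (-w)
        (s₁ • wedge β η + s₂ • wedge α γ + s₃ • ((n * lam) • wedge α β + k • wedge γ η))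
        (s₁ • c)) ∧
    (∃ c : LichCohomology (-w) 3, c ≠ 0 ∧ Represents (-w) (wedge β (wedge γ η)) c) := by
  have hk0 : k ≠ 0 := by
    rintro rfl
    obtain ⟨m, hm, h⟩ := hk
    -- The excluded value 2 is the one attained at k = 0.
    apply hm
    rw [neg_zero, Real.exp_zero] at h
    exact_mod_cast (h.symm.trans one_add_one_eq_two)
  have hp := hπ.smooth_proj
  have sα : IsSmooth α := hα ▸ isSmooth_pullback_descend Γ hp G.alpha_right_invariant
    G.contDiff_alpha
  have sβ : IsSmooth β := hβ ▸ isSmooth_pullback_descend Γ hp G.beta_right_invariant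
    G.contDiff_beta
  have sγ : IsSmooth γ := hγ ▸ isSmooth_pullback_descend Γ hp G.gamma_right_invariant
    G.contDiff_gamma
  have dα : extD α = k • wedge γ α := by
    rw [hα, hγ]
    exact extD_pullback_descend Γ hp G.alpha_right_invariant G.gamma_right_invariant
      G.alpha_right_invariant G.contDiff_alpha G.extDeriv_alpha
  have dβ : extD β = (-k) • wedge γ β := by
    rw [hβ, hγ]
    exact extD_pullback_descend Γ hp G.beta_right_invariant G.gamma_right_invariant
      G.beta_right_invariant G.contDiff_beta G.extDeriv_beta
  have dγ : extD γ = 0 := by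
    rw [← zero_smul ℝ (wedge γ γ), hγ]
    exact extD_pullback_descend Γ hp G.gamma_right_invariant G.gamma_right_invariant
      G.gamma_right_invariant G.contDiff_gamma G.extDeriv_gamma
  have hvol : ∀ ν : Form (EuclideanSpace ℝ (Fin 4)) M 3, IsSmooth ν →
      extD ν ≠ wedge α (wedge β (wedge γ η)) := fun ν hν h =>
    extD_ne_volumeForm (EuclideanSpace.basisFun (Fin 4) ℝ).toBasis hπ hη hν
      (by rw [h, hα, hβ, hγ]; rfl)
  obtain ⟨h1, h2, h3⟩ := lichnerowicz_classes hk0 sα sβ sγ hη.smooth dα dβ dγ hcurv hw hvol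
  have dη : extD η = (-(n * lam)) • wedge β α := by
    rw [hcurv, wedge_one_comm α β]
    module
  -- Exchanging α and β reverses the signs of k, of the curvature constant and of the volume form; a
  -- primitive ν of the new volume form gives the primitive -ν of the old one.
  obtain ⟨h4, ⟨c, hc, hc', h5⟩, h6⟩ := lichnerowicz_classes (w := -w) (neg_ne_zero.2 hk0) sβ sα sγ
    hη.smooth dβ (by rw [neg_neg]; exact dα) dγ dη (by rw [hw]; module)
    fun ν hν h => hvol (-ν) hν.neg (by rw [extD_neg, h, wedge_comm β α, neg_neg])
  refine ⟨h1, h2, h3, h4, ⟨c, hc, hc', fun s₁ s₂ s₃ => ?_⟩, h6⟩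
  have e : (-(n * lam)) • wedge β α - (-k) • wedge γ η =
      (n * lam) • wedge α β + k • wedge γ η := by
    rw [wedge_one_comm α β]
    module
  rw [← e]
  exact h5 s₁ s₂ s₃
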